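/- For an integer $d\ge 2$ and $0<\sigma<1$, and for a two-element set $I\subseteq\{1,\dots,d\}$, let $\eta_{I,\sigma}$ be the centered Gaussian distribution on $\mathbb{R}^d$ whose covariance matrix has diagonal entries $1$, entries $\sigma$ at $(i,j)$ and $(j,i)$ where $I=\{i,j\}$, and all other entries $0$. For integers $t,s,\ell\ge1$, a $(t,s,\ell)$-algorithm goes sequentially, $\ell$ times, over $t$ data points in $\mathbb{R}^d$ using $s$ bits of memory: writing $x_1,\dots,x_{t\ell}$ for $\ell$ consecutive copies of the data set, it starts from a fixed $u_1\in\{0,1\}^s$, computes $u_{i+1}=f_i(x_i,u_i)\in\{0,1\}^s$ for $1\le i\le t\ell$, where the $f_i$ are arbitrary (measurable) functions, and outputs a two-element subset of $\{1,\dots,d\}$ that is a function of $u_{t\ell+1}$. It identifies the correlated pair with error $\varepsilon$ if for every two-element $I\subseteq\{1,\dots,d\}$, when the $t$ data points are i.i.d. samples from $\eta_{I,\sigma}$, its output equals $I$ with probability at least $1-\varepsilon$. There exist numerical constants $C,C'>0$ such that the following holds. If $d\ge C'$, then for any $\sigma$ with $0<\sigma<1$ and \[ \sigma\le\Bigl(C\,d^{3}\,\ln^{1/2}d\;\ln(d/\sigma)\Bigr)^{-1},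 \] and any integers $t,s,\ell\ge1$, any $(t,s,\ell)$-algorithm identifying the correlated pair with error $1/6$ satisfies \[ ts\ell\;\ge\;\frac{d^2}{C\,\sigma^2\,\ln^3 d\;\ln^2(1/\sigma)}. \] -/

import Mathlib

open MeasureTheory ProbabilityTheory

/-- An algorithm with `s` bits of memory that makes `ℓ` sequential passes over `t` data points from
`X` and then outputs an element of `O`.  Its update function may depend arbitrarily on the time
step; step number `i` (counted from `0`) of the `ℓ * t` steps processes data point `i mod t`. -/
structure MemoryAlgorithm (X O : Type*) [MeasurableSpace X] (t s ℓ : ℕ) where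
  /-- the memory content before the first data point is read -/
  init : Fin s → Bool
  /-- the update of the memory at each of the `ℓ * t` time steps -/
  step : Fin (ℓ * t) → X → (Fin s → Bool) → (Fin s → Bool)
  /-- the updates are measurable, so that the algorithm has success probabilities -/
  measurable_step : ∀ i u, Measurable fun x => step i x u
  /-- the output, a function of the final memory content only -/
  output : (Fin s → Bool) → O

namespace MemoryAlgorithm

variable {X O : Type*} [MeasurableSpace X] {t s ℓ : ℕ}

/-- The memory content after the first `j` time steps, on the data set `x`. -/
def memory (A : MemoryAlgorithm X O t s ℓ) (x : Fin t → X) :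
    (j : ℕ) → j ≤ ℓ * t → (Fin s → Bool)
  | 0, _ => A.init
  | j + 1, h =>
    A.step ⟨j, h⟩ (x (Fin.modNat (⟨j, h⟩ : Fin (ℓ * t)))) (A.memory x j (Nat.le_of_succ_le h))

/-- The output of the algorithm on the data set `x`, after all `ℓ` passes. -/
def result (A : MemoryAlgorithm X O t s ℓ) (x : Fin t → X) : O :=
  A.output (A.memory x (ℓ * t) le_rfl)

/-- The algorithm identifies the members of the family `μ` with error `ε`: for every index `i`, on
`t` i.i.d. samples from `μ i` it outputs `i` with probability at least `1 - ε`. -/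
def IdentifiesWithError {ι : Type*} (A : MemoryAlgorithm X ι t s ℓ) (μ : ι → Measure X)
    (ε : ℝ) : Prop :=
  ∀ i, 1 - ε ≤ (Measure.pi fun _ : Fin t => μ i).real {x | A.result x = i}

end MemoryAlgorithm

/-- The two-element subsets of the set of `d` coordinates. -/
abbrev CoordPair (d : ℕ) : Type := {I : Finset (Fin d) // I.card = 2}

/-- The covariance matrix with unit variances in which exactly the two coordinates in `I` are
correlated, with correlation `σ`. -/
def pairCovariance {d : ℕ} (I : CoordPair d) (σ : ℝ) : Matrix (Fin d) (Fin d) ℝ :=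
  Matrix.of fun i j => if i = j then 1 else if I.1 = {i, j} then σ else 0

/-- The centered Gaussian distribution on `ℝ^d` with covariance matrix `pairCovariance I σ`. -/
noncomputable def pairGaussian (d : ℕ) (σ : ℝ) (I : CoordPair d) :
    Measure (EuclideanSpace ℝ (Fin d)) :=
  multivariateGaussian 0 (pairCovariance I σ)

/-! Each law with a correlated pair `I` is compared with the null law, under which all coordinates
are independent. The transcript, i.e. the list of all memory states, has nearly the same
distribution under both laws for most `I`, unless `t s ℓ σ²` is of order `d²`.

Group the data into `k` blocks of `m = 8 d²` points. The data sets consistent with a transcript form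
a product of cells, one for each block, so transcript probabilities are products `∏ P(A_j)`. With
`δ_j = Q(A_j) / P(A_j) - 1` the likelihood ratio is `∏ (1 + δ_j)`. Under the null law the `δ_j` are
centered and uncorrelated, whence `Q(T) ≥ e⁻¹ (P(T) - 8 ∑ E δ_j²)` for every set `T` of transcripts
(`exp_neg_one_mul_sub_le_sum_prod`). Taking for `T` the wrong outputs and summing over the `N` pairs
gives `N ≤ 20 ∑_j ∑_I E δ_{j,I}²` (`card_le_sum_relChange_sq`).

The sum over `I` is small because a cell cannot bias all empirical correlations at once. The block
density is `1 + σ Z_I` plus a remainder that is small in `L²`. The moment generating function of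
quadratic forms bounds the norm of the vector of averages of the `Z_I` over a cell of probability
`p` by order `√(m log p⁻¹)` (`sqrt_sum_setAverage_blockCorr_sq_le`). Given the other blocks only
`2^(s ℓ)` transcripts are possible, so `log p⁻¹` is of order `s ℓ` in mean square
(`sum_prod_mul_log_inv_sq_le`). A block thus contributes `O(σ² m s ℓ)`, and `k m ≈ t` yields `d² ≲
σ² t s ℓ`. This works for `s ℓ ≤ d²`. For larger memory the crude bound `E δ² ≤ 2 m σ²` already
forces `t σ² ≳ 1`.

The resulting bound `d² ≤ 10⁵ σ² t s ℓ` has no logarithms. Those in the theorem are at least `1` and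
only weaken it. -/

/-! ### Elementary lower bound for a product of factors near one. -/

theorem measureReal_pi_pi {κ Ω : Type*} [Fintype κ] [MeasurableSpace Ω]
    (μ : κ → Measure Ω) [∀ j, IsFiniteMeasure (μ j)] (s : κ → Set Ω) :
    (Measure.pi μ).real (Set.univ.pi s) = ∏ j, (μ j).real (s j) := by
  simp [Measure.real, Measure.pi_pi, ENNReal.toReal_prod]

theorem exp_sub_two_sq_le {x : ℝ} (h : |x| ≤ 1 / 2) : Real.exp (x - 2 * x ^ 2) ≤ 1 + x := by
  obtain ⟨h1, h2⟩ := abs_le.1 h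
  have hp : 0 < 1 + x := by linarith
  rw [← Real.le_log_iff_exp_le hp]
  refine le_trans ?_ (Real.one_sub_inv_le_log_of_pos hp)
  rw [← sub_nonneg]
  have : 1 - (1 + x)⁻¹ - (x - 2 * x ^ 2) = x ^ 2 * (1 + 2 * x) / (1 + x) := by
    field_simp; ring
  rw [this]
  have : 0 ≤ 1 + 2 * x := by linarith
  positivity

/-- If the left side is positive, then every `|δ j| ≤ 1/2`, `∑ δ j ≥ -1/2` and `2 ∑ δ j² ≤ 1/2`, so
the product is at least `exp (∑ δ j - 2 ∑ δ j²) ≥ e⁻¹`. Only first and second moments of the `δ j`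
enter, and these can be averaged over transcripts. -/
theorem exp_neg_one_mul_le_prod_one_add {κ : Type*} [Fintype κ] (δ : κ → ℝ) (hδ : ∀ j, 0 ≤ 1 + δ j) :
    Real.exp (-1) * (1 - 4 * ∑ j, δ j ^ 2 - 4 * (∑ j, δ j) ^ 2) ≤ ∏ j, (1 + δ j) := by
  by_cases h : 1 - 4 * ∑ j, δ j ^ 2 - 4 * (∑ j, δ j) ^ 2 ≤ 0
  · exact (mul_nonpos_of_nonneg_of_nonpos (Real.exp_pos _).le h).trans
      (Finset.prod_nonneg fun j _ => hδ j)
  push Not at h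
  have hs : 0 ≤ ∑ j, δ j ^ 2 := Finset.sum_nonneg fun j _ => sq_nonneg _
  have h1 : ∑ j, δ j ^ 2 ≤ 1 / 4 := by nlinarith [sq_nonneg (∑ j, δ j)]
  have h2 : |∑ j, δ j| ≤ 1 / 2 := by
    apply abs_le_of_sq_le_sq _ (by norm_num)
    nlinarith
  have h3 : ∀ j, |δ j| ≤ 1 / 2 := fun j => by
    apply abs_le_of_sq_le_sq _ (by norm_num)
    have := Finset.single_le_sum (f := fun j => δ j ^ 2) (fun i _ => sq_nonneg _)
      (Finset.mem_univ j)
    linarith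
  calc Real.exp (-1) * (1 - 4 * ∑ j, δ j ^ 2 - 4 * (∑ j, δ j) ^ 2) ≤ Real.exp (-1) * 1 := by
        gcongr
        nlinarith [sq_nonneg (∑ j, δ j)]
    _ ≤ Real.exp (∑ j, (δ j - 2 * δ j ^ 2)) := by
        rw [mul_one, Finset.sum_sub_distrib, ← Finset.mul_sum]
        gcongr
        linarith [(abs_le.1 h2).1]
    _ = ∏ j, Real.exp (δ j - 2 * δ j ^ 2) := Real.exp_sum _ _
    _ ≤ _ := Finset.prod_le_prod (fun j _ => (Real.exp_pos _).le)
        fun j _ => exp_sub_two_sq_le (h3 j)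

/-! ### Partitions of a power of a space into rectangles, and change of the factor measure. -/

section RectangularPartition

variable {κ Ω Γ : Type*} [Fintype κ] [MeasurableSpace Ω] [Fintype Γ]
  {A : κ → Γ → Set Ω}

/-- Product measures are additive over a partition of a power of `Ω` into rectangles. -/
theorem sum_prod_measureReal (hA : ∀ j π, MeasurableSet (A j π))
    (hpart : ∀ x : κ → Ω, ∃! π, ∀ j, x j ∈ A j π)
    (μ : κ → Measure Ω) [∀ j, IsFiniteMeasure (μ j)] :
    ∑ π, ∏ j, (μ j).real (A j π) = ∏ j, (μ j).real Set.univ := by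
  have hu : (⋃ π, Set.univ.pi fun j => A j π) = Set.univ.pi fun _ => Set.univ := by
    ext x
    obtain ⟨π, hπ, -⟩ := hpart x
    simpa using ⟨π, hπ⟩
  simp_rw [← measureReal_pi_pi, ← hu]
  rw [measureReal_iUnion_fintype]
  · intro π π' hne
    refine Set.disjoint_left.2 fun x hx hx' => hne ?_
    exact (hpart x).unique (fun j => hx j (Set.mem_univ j)) (fun j => hx' j (Set.mem_univ j))
  · exact fun π => MeasurableSet.univ_pi fun j => hA j π

variable [DecidableEq κ]

/-- This is additivity for the product measure with `ν` in slot `j` and `P` elsewhere. It is used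
with `ν = P` and, for Bessel's inequality, with `ν` of density `f²`. -/
theorem sum_measureReal_mul_prod_erase (hA : ∀ j π, MeasurableSet (A j π))
    (hpart : ∀ x : κ → Ω, ∃! π, ∀ j, x j ∈ A j π)
    (P ν : Measure Ω) [IsProbabilityMeasure P] [IsFiniteMeasure ν] (j : κ) :
    ∑ π, ν.real (A j π) * ∏ i ∈ Finset.univ.erase j, P.real (A i π) = ν.real Set.univ := by
  have hf : ∀ i, IsFiniteMeasure (if i = j then ν else P) := fun i => by
    split_ifs <;> infer_instance
  have h := sum_prod_measureReal hA hpart (fun i => if i = j then ν else P)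
  simp_rw [← Finset.mul_prod_erase Finset.univ _ (Finset.mem_univ j)] at h
  have h1 : ∏ x ∈ Finset.univ.erase j, (if x = j then ν else P).real Set.univ = 1 :=
    Finset.prod_eq_one fun i hi => by simp [Finset.ne_of_mem_erase hi]
  rw [h1] at h
  simp only [if_true, mul_one] at h
  rw [← h]
  refine Finset.sum_congr rfl fun π _ => ?_
  congr 1
  exact Finset.prod_congr rfl fun i hi => by simp [Finset.ne_of_mem_erase hi]

/-- If all coordinates but the `j`-th leave at most `B` cells of the partition possible, then the
measures of the cells without their `j`-th factors add up to at most `B`. -/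
theorem sum_prod_erase_le (hA : ∀ j π, MeasurableSet (A j π)) (P : Measure Ω)
    [IsProbabilityMeasure P] (j : κ) {B : ℕ}
    (hB : ∀ (x : κ → Ω) (s : Finset Γ), (∀ π ∈ s, ∀ i, i ≠ j → x i ∈ A i π) → s.card ≤ B) :
    ∑ π, ∏ i ∈ Finset.univ.erase j, P.real (A i π) ≤ B := by
  classical
  -- Dropping the constraint on coordinate `j` makes the rectangles overlap. The sum is the expected
  -- number of those containing a random point, and this number never exceeds `B`.
  let R : Γ → Set (κ → Ω) := fun π => Set.univ.pi fun i => if i = j then Set.univ else A i π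
  have hR : ∀ π, MeasurableSet (R π) := fun π => MeasurableSet.univ_pi fun i => by
    split_ifs
    exacts [MeasurableSet.univ, hA i π]
  have h1 : ∀ π, ∏ i ∈ Finset.univ.erase j, P.real (A i π)
      = ∫ x, (R π).indicator (fun _ => (1 : ℝ)) x ∂(Measure.pi fun _ : κ => P) := by
    intro π
    rw [integral_indicator (hR π), setIntegral_const, smul_eq_mul, mul_one, measureReal_pi_pi,
      ← Finset.mul_prod_erase Finset.univ _ (Finset.mem_univ j)]
    simp only [if_true, probReal_univ, one_mul]
    exact Finset.prod_congr rfl fun i hi => by simp [Finset.ne_of_mem_erase hi]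
  simp_rw [h1]
  have hi : ∀ π, Integrable ((R π).indicator (fun _ => (1 : ℝ))) (Measure.pi fun _ : κ => P) :=
    fun π => (integrable_const _).indicator (hR π)
  rw [← integral_finsetSum _ fun π _ => hi π]
  calc ∫ x, ∑ π, (R π).indicator (fun _ => (1 : ℝ)) x ∂(Measure.pi fun _ : κ => P)
      ≤ ∫ x, (B : ℝ) ∂(Measure.pi fun _ : κ => P) := by
        refine integral_mono (integrable_finsetSum _ fun π _ => hi π) (integrable_const _) ?_
        intro x
        simp only [Set.indicator_apply]
        rw [Finset.sum_boole]
        exact_mod_cast hB x _ fun π hπ i hij => by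
          have := (Finset.mem_filter.1 hπ).2 i (Set.mem_univ i)
          simpa [hij] using this
    _ = B := by simp

/-- With `u = log p⁻¹` and `b = log B`, the case `u ≤ b` is clear. Otherwise `u² ≤ 2 b² + 2 (u -
b)²`, and `(u - b)² ≤ 2 exp (u - b) = 2 / (p B)`. -/
theorem mul_log_inv_sq_le {p B : ℝ} (hp : 0 ≤ p) (hp1 : p ≤ 1) (hB : 1 ≤ B) :
    p * Real.log p⁻¹ ^ 2 ≤ p * (2 * Real.log B ^ 2) + 4 / B := by
  rcases hp.eq_or_lt with rfl | hp
  · simp; positivity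
  have hB0 : 0 < B := by linarith
  have hu : 0 ≤ Real.log p⁻¹ := Real.log_nonneg ((one_le_inv₀ hp).2 hp1)
  have hb : 0 ≤ Real.log B := Real.log_nonneg hB
  set u := Real.log p⁻¹ with hu_def
  set b := Real.log B with hb_def
  have hpe : p = Real.exp (-u) := by
    rw [hu_def, Real.log_inv, neg_neg, Real.exp_log hp]
  have hBe : B = Real.exp b := (Real.exp_log hB0).symm
  rcases le_total u b with h | h
  · have : p * u ^ 2 ≤ p * (2 * b ^ 2) := by
      apply mul_le_mul_of_nonneg_left _ hp.le
      nlinarith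
    have : 0 ≤ 4 / B := by positivity
    linarith
  · have h1 := Real.quadratic_le_exp_of_nonneg (sub_nonneg.2 h)
    have h2 : u ^ 2 ≤ 2 * b ^ 2 + 2 * (u - b) ^ 2 := by nlinarith [sq_nonneg (u - 2 * b)]
    have h3 : p * (2 * (u - b) ^ 2) ≤ 4 / B := by
      rw [le_div_iff₀ hB0]
      have h4 : p * B * Real.exp (u - b) = 1 := by
        rw [hpe, hBe, ← Real.exp_add, ← Real.exp_add, ← Real.exp_zero]
        congr 1; ring
      have h5 : (u - b) ^ 2 ≤ 2 * Real.exp (u - b) := by linarith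
      calc p * (2 * (u - b) ^ 2) * B = 2 * (p * B) * (u - b) ^ 2 := by ring
        _ ≤ 2 * (p * B) * (2 * Real.exp (u - b)) := by gcongr
        _ = 4 := by linear_combination 4 * h4
    calc p * u ^ 2 ≤ p * (2 * b ^ 2 + 2 * (u - b) ^ 2) := by gcongr
      _ ≤ _ := by linarith

/-- The pointwise bound `mul_log_inv_sq_le` is weighted by the product over `i ≠ j`: these weights
sum to `1` with the factor `p` and to at most `B` without it, so the error `4 / B` costs only `4`.
-/
theorem sum_prod_mul_log_inv_sq_le (hA : ∀ j π, MeasurableSet (A j π)) (P : Measure Ω)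
    [IsProbabilityMeasure P]
    (hpart : ∀ x : κ → Ω, ∃! π, ∀ j, x j ∈ A j π) (j : κ) {B : ℕ} (hB1 : 1 ≤ B)
    (hB : ∀ (x : κ → Ω) (s : Finset Γ), (∀ π ∈ s, ∀ i, i ≠ j → x i ∈ A i π) → s.card ≤ B) :
    ∑ π, (∏ i, P.real (A i π)) * Real.log (P.real (A j π))⁻¹ ^ 2 ≤ 2 * Real.log B ^ 2 + 4 := by
  have hBr : (1 : ℝ) ≤ B := by exact_mod_cast hB1
  have hB0 : (0 : ℝ) < B := by linarith
  have h1 := sum_prod_erase_le hA P j hB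
  have h2 := sum_measureReal_mul_prod_erase hA hpart P P j
  have hq : ∀ π, 0 ≤ ∏ i ∈ Finset.univ.erase j, P.real (A i π) := fun π =>
    Finset.prod_nonneg fun i _ => measureReal_nonneg
  calc ∑ π, (∏ i, P.real (A i π)) * Real.log (P.real (A j π))⁻¹ ^ 2
      = ∑ π, (P.real (A j π) * Real.log (P.real (A j π))⁻¹ ^ 2) *
          ∏ i ∈ Finset.univ.erase j, P.real (A i π) := by
        refine Finset.sum_congr rfl fun π _ => ?_
        rw [← Finset.mul_prod_erase Finset.univ _ (Finset.mem_univ j)]; ring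
    _ ≤ ∑ π, (P.real (A j π) * (2 * Real.log B ^ 2) + 4 / B) *
          ∏ i ∈ Finset.univ.erase j, P.real (A i π) := by
        refine Finset.sum_le_sum fun π _ => mul_le_mul_of_nonneg_right ?_ (hq π)
        exact mul_log_inv_sq_le measureReal_nonneg measureReal_le_one hBr
    _ = (2 * Real.log B ^ 2) * (∑ π, P.real (A j π) * ∏ i ∈ Finset.univ.erase j, P.real (A i π))
          + 4 / B * ∑ π, ∏ i ∈ Finset.univ.erase j, P.real (A i π) := by
        rw [Finset.mul_sum, Finset.mul_sum, ← Finset.sum_add_distrib]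
        refine Finset.sum_congr rfl fun π _ => by ring
    _ ≤ (2 * Real.log B ^ 2) * 1 + 4 / B * B := by
        rw [h2, probReal_univ]; gcongr
    _ = _ := by field_simp

/-- The relative change of the probability of `s` on passing from `P` to `Q`. -/
noncomputable def relChange (P Q : Measure Ω) (s : Set Ω) : ℝ := Q.real s / P.real s - 1

/-- On null sets `relChange` takes the value `-1` by division by zero. Absolute continuity makes the
identity hold there too. -/
theorem measureReal_mul_relChange {P Q : Measure Ω} [IsFiniteMeasure P] (hQ : Q ≪ P)
    (s : Set Ω) : P.real s * (1 + relChange P Q s) = Q.real s := by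
  by_cases h : P.real s = 0
  · have : P s = 0 := by simpa [Measure.real, ENNReal.toReal_eq_zero_iff] using h
    have hq : Q.real s = 0 := by simp [Measure.real, hQ this]
    rw [h, hq, zero_mul]
  · rw [relChange]; field_simp; ring

/-- The sum is the total mass of the product measure with `Q` in the slots of `S` and `P` in the
others. Singletons and pairs `S` show that the relative changes are centered and uncorrelated under
`P`. -/
theorem sum_prod_mul_prod_relChange (hA : ∀ j π, MeasurableSet (A j π))
    (hpart : ∀ x : κ → Ω, ∃! π, ∀ j, x j ∈ A j π) {P Q : Measure Ω} [IsProbabilityMeasure P]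
    [IsProbabilityMeasure Q] (hQ : Q ≪ P) (S : Finset κ) :
    ∑ π, (∏ j, P.real (A j π)) * ∏ j ∈ S, (1 + relChange P Q (A j π)) = 1 := by
  have hf : ∀ i, IsProbabilityMeasure (if i ∈ S then Q else P) := fun i => by
    split_ifs <;> infer_instance
  have h := sum_prod_measureReal hA hpart (fun i => if i ∈ S then Q else P)
  simp only [probReal_univ, Finset.prod_const_one] at h
  refine Eq.trans (Finset.sum_congr rfl fun π _ => ?_) h
  have : ∏ j ∈ S, (1 + relChange P Q (A j π))
      = ∏ j, if j ∈ S then 1 + relChange P Q (A j π) else 1 := by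
    rw [Finset.prod_ite_mem]; simp
  rw [this, ← Finset.prod_mul_distrib]
  refine Finset.prod_congr rfl fun j _ => ?_
  split_ifs
  · exact measureReal_mul_relChange hQ _
  · simp

theorem sum_prod_mul_sum_relChange_sq (hA : ∀ j π, MeasurableSet (A j π))
    (hpart : ∀ x : κ → Ω, ∃! π, ∀ j, x j ∈ A j π) {P Q : Measure Ω} [IsProbabilityMeasure P]
    [IsProbabilityMeasure Q] (hQ : Q ≪ P) :
    ∑ π, (∏ j, P.real (A j π)) * (∑ j, relChange P Q (A j π)) ^ 2
      = ∑ j, ∑ π, (∏ i, P.real (A i π)) * relChange P Q (A j π) ^ 2 := by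
  have h0 := sum_prod_mul_prod_relChange hA hpart hQ ∅
  have h1 : ∀ j, ∑ π, (∏ i, P.real (A i π)) * relChange P Q (A j π) = 0 := by
    intro j
    have := sum_prod_mul_prod_relChange hA hpart hQ {j}
    simp only [Finset.prod_singleton, mul_add, Finset.sum_add_distrib] at this
    simp only [Finset.prod_empty] at h0
    linarith
  have h2 : ∀ j i, ∑ π, (∏ a, P.real (A a π)) * (relChange P Q (A j π) * relChange P Q (A i π))
      = if i = j then ∑ π, (∏ a, P.real (A a π)) * relChange P Q (A j π) ^ 2 else 0 := by
    intro j i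
    split_ifs with hij
    · subst hij
      simp [sq]
    · have := sum_prod_mul_prod_relChange hA hpart hQ {j, i}
      rw [Finset.sum_congr rfl fun π _ => by rw [Finset.prod_pair (Ne.symm hij)]] at this
      have e : ∀ π, (∏ a, P.real (A a π)) *
          ((1 + relChange P Q (A j π)) * (1 + relChange P Q (A i π)))
          = (∏ a, P.real (A a π)) * 1 + (∏ a, P.real (A a π)) * relChange P Q (A j π)
            + (∏ a, P.real (A a π)) * relChange P Q (A i π)
            + (∏ a, P.real (A a π)) * (relChange P Q (A j π) * relChange P Q (A i π)) :=
        fun π => by ring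
      simp only [e, Finset.sum_add_distrib, h1] at this
      simp only [Finset.prod_empty] at h0
      linarith
  calc ∑ π, (∏ j, P.real (A j π)) * (∑ j, relChange P Q (A j π)) ^ 2
      = ∑ j, ∑ i, ∑ π, (∏ a, P.real (A a π)) *
          (relChange P Q (A j π) * relChange P Q (A i π)) := by
        simp_rw [sq, Finset.sum_mul_sum, Finset.mul_sum]
        rw [Finset.sum_comm]
        exact Finset.sum_congr rfl fun j _ => Finset.sum_comm
    _ = _ := by simp [h2]

/-- Changing every factor from `P` to `Q` decreases the probability of a union of cells of the
partition little if the relative changes of the individual factors are small in mean square. -/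
theorem exp_neg_one_mul_sub_le_sum_prod (hA : ∀ j π, MeasurableSet (A j π))
    (hpart : ∀ x : κ → Ω, ∃! π, ∀ j, x j ∈ A j π) {P Q : Measure Ω} [IsProbabilityMeasure P]
    [IsProbabilityMeasure Q] (hQ : Q ≪ P) (T : Finset Γ) :
    Real.exp (-1) * (∑ π ∈ T, ∏ j, P.real (A j π)
        - 8 * ∑ j, ∑ π, (∏ i, P.real (A i π)) * relChange P Q (A j π) ^ 2)
      ≤ ∑ π ∈ T, ∏ j, Q.real (A j π) := by
  have hP : ∀ π, 0 ≤ ∏ j, P.real (A j π) := fun π =>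
    Finset.prod_nonneg fun i _ => measureReal_nonneg
  -- `E` is the error term of `exp_neg_one_mul_le_prod_one_add`. By orthogonality its two halves
  -- have the same mean, hence the factor `8`.
  set E : Γ → ℝ := fun π => 4 * ∑ j, relChange P Q (A j π) ^ 2
    + 4 * (∑ j, relChange P Q (A j π)) ^ 2 with hE
  have hE0 : ∀ π, 0 ≤ E π := fun π => by positivity
  have hsum : ∑ π, (∏ j, P.real (A j π)) * E π
      = 8 * ∑ j, ∑ π, (∏ i, P.real (A i π)) * relChange P Q (A j π) ^ 2 := by
    have h := sum_prod_mul_sum_relChange_sq hA hpart hQ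
    simp only [hE, mul_add, Finset.sum_add_distrib, mul_left_comm _ (4 : ℝ), ← Finset.mul_sum]
    rw [h, Finset.sum_congr rfl fun π _ => Finset.mul_sum _ _ _, Finset.sum_comm]
    ring
  calc Real.exp (-1) * (∑ π ∈ T, ∏ j, P.real (A j π)
        - 8 * ∑ j, ∑ π, (∏ i, P.real (A i π)) * relChange P Q (A j π) ^ 2)
      ≤ Real.exp (-1) * ∑ π ∈ T, (∏ j, P.real (A j π)) * (1 - E π) := by
        gcongr
        rw [← hsum]
        simp only [mul_sub, mul_one, Finset.sum_sub_distrib]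
        gcongr
        exact Finset.subset_univ T
    _ ≤ ∑ π ∈ T, ∏ j, Q.real (A j π) := by
        rw [Finset.mul_sum]
        refine Finset.sum_le_sum fun π _ => ?_
        have hq : ∏ j, Q.real (A j π)
            = (∏ j, P.real (A j π)) * ∏ j, (1 + relChange P Q (A j π)) := by
          rw [← Finset.prod_mul_distrib]
          exact Finset.prod_congr rfl fun j _ => (measureReal_mul_relChange hQ _).symm
        rw [hq, mul_left_comm]
        refine mul_le_mul_of_nonneg_left ?_ (hP π)
        have := exp_neg_one_mul_le_prod_one_add (fun j => relChange P Q (A j π)) fun j => by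
          rw [relChange, add_sub_cancel]
          exact div_nonneg measureReal_nonneg measureReal_nonneg
        rw [hE]
        simpa [sub_sub] using this

end RectangularPartition

/-! ### Densities and square integrals of one-dimensional centered Gaussians. -/

/-- A product of measures with densities has the product of the densities as its density. -/
theorem pi_eq_withDensity_prod {ι : Type*} [Fintype ι] {α : ι → Type*}
    [∀ i, MeasurableSpace (α i)] {μ ν : ∀ i, Measure (α i)} [∀ i, SigmaFinite (μ i)]
    [∀ i, SigmaFinite (ν i)] {f : ∀ i, α i → ℝ} (hf : ∀ i, Integrable (f i) (μ i))
    (hf0 : ∀ i x, 0 ≤ f i x) (hν : ∀ i, ν i = (μ i).withDensity fun x => ENNReal.ofReal (f i x)) :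
    Measure.pi ν = (Measure.pi μ).withDensity fun x => ENNReal.ofReal (∏ i, f i (x i)) := by
  refine Measure.pi_eq (μ := ν) fun s hs => ?_
  rw [withDensity_apply _ (MeasurableSet.univ_pi hs), Measure.restrict_pi_pi,
    ← ofReal_integral_eq_lintegral_ofReal, integral_fintype_prod_eq_prod,
    ENNReal.ofReal_prod_of_nonneg]
  · refine Finset.prod_congr rfl fun i _ => ?_
    rw [hν, withDensity_apply _ (hs i), ofReal_integral_eq_lintegral_ofReal]
    · exact (hf i).integrableOn
    · exact ae_of_all _ (hf0 i)
  · exact fun i _ => integral_nonneg (hf0 i)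
  · exact Integrable.fintype_prod_dep fun i => (hf i).integrableOn
  · exact ae_of_all _ fun x => Finset.prod_nonneg fun i _ => hf0 i _

theorem gaussianPDFReal_zero_one (x : ℝ) :
    gaussianPDFReal 0 1 x = (√(2 * Real.pi))⁻¹ * Real.exp (-(1 / 2) * x ^ 2) := by
  rw [gaussianPDFReal_def]
  simp only [NNReal.coe_one, mul_one, sub_zero]
  congr 2
  ring

theorem integrable_exp_mul_sq_gaussianReal {a : ℝ} (ha : a < 1 / 2) :
    Integrable (fun x => Real.exp (a * x ^ 2)) (gaussianReal 0 1) := by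
  rw [gaussianReal_of_var_ne_zero _ one_ne_zero, integrable_withDensity_iff_integrable_smul'
    (measurable_gaussianPDF _ _) (ae_of_all _ fun _ => gaussianPDF_lt_top)]
  have : (fun x => (gaussianPDF 0 1 x).toReal • Real.exp (a * x ^ 2))
      = fun x => (√(2 * Real.pi))⁻¹ * Real.exp (-(1 / 2 - a) * x ^ 2) := by
    ext x
    rw [toReal_gaussianPDF, gaussianPDFReal_zero_one, smul_eq_mul, mul_assoc, ← Real.exp_add]
    congr 2; ring
  rw [this]
  exact (integrable_exp_neg_mul_sq (by linarith)).const_mul _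

theorem integral_exp_mul_sq_gaussianReal {a : ℝ} (ha : a < 1 / 2) :
    ∫ x, Real.exp (a * x ^ 2) ∂(gaussianReal 0 1) = (√(1 - 2 * a))⁻¹ := by
  rw [integral_gaussianReal_eq_integral_smul one_ne_zero]
  have : (fun x => gaussianPDFReal 0 1 x • Real.exp (a * x ^ 2))
      = fun x => (√(2 * Real.pi))⁻¹ * Real.exp (-(1 / 2 - a) * x ^ 2) := by
    ext x
    rw [gaussianPDFReal_zero_one, smul_eq_mul, mul_assoc, ← Real.exp_add]
    congr 2; ring
  have h2 : 0 < 1 / 2 - a := by linarith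
  rw [this, integral_const_mul, integral_gaussian, ← Real.sqrt_inv, ← Real.sqrt_inv,
    ← Real.sqrt_mul (by positivity)]
  congr 1
  have := Real.pi_pos
  have h3 : 1 - 2 * a ≠ 0 := by linarith
  field_simp

/-- The density of the centered Gaussian with variance `v` relative to the standard one. -/
noncomputable def gaussianRatio (v x : ℝ) : ℝ :=
  (√v)⁻¹ * Real.exp ((1 - v⁻¹) / 2 * x ^ 2)

theorem gaussianRatio_nonneg (v x : ℝ) : 0 ≤ gaussianRatio v x := by
  unfold gaussianRatio; positivity

theorem measurable_gaussianRatio (v : ℝ) : Measurable (gaussianRatio v) := by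
  unfold gaussianRatio; fun_prop

theorem integrable_gaussianRatio {v : ℝ} (hv : 0 < v) :
    Integrable (gaussianRatio v) (gaussianReal 0 1) := by
  refine (integrable_exp_mul_sq_gaussianReal ?_).const_mul _
  have : 0 < v⁻¹ := by positivity
  linarith

theorem gaussianRatio_sq {v : ℝ} (hv : 0 < v) (x : ℝ) :
    gaussianRatio v x ^ 2 = v⁻¹ * Real.exp ((1 - v⁻¹) * x ^ 2) := by
  rw [gaussianRatio, mul_pow, inv_pow, Real.sq_sqrt hv.le, ← Real.exp_nat_mul]
  congr 2; push_cast; ring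

theorem integrable_gaussianRatio_sq {v : ℝ} (hv : 0 < v) (hv2 : v < 2) :
    Integrable (fun x => gaussianRatio v x ^ 2) (gaussianReal 0 1) := by
  simp_rw [gaussianRatio_sq hv]
  refine (integrable_exp_mul_sq_gaussianReal ?_).const_mul _
  have : (2 : ℝ)⁻¹ < v⁻¹ := by gcongr
  linarith

/-- The integral converges exactly because `1 - v⁻¹ < 1/2`, that is `v < 2`. The value depends only
on `(v - 1)²`, the squared eigenvalue of the perturbation. -/
theorem integral_gaussianRatio_sq {v : ℝ} (hv : 0 < v) (hv2 : v < 2) :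
    ∫ x, gaussianRatio v x ^ 2 ∂(gaussianReal 0 1) = (√(1 - (v - 1) ^ 2))⁻¹ := by
  simp_rw [gaussianRatio_sq hv]
  have h1 : (2 : ℝ)⁻¹ < v⁻¹ := by gcongr
  rw [integral_const_mul, integral_exp_mul_sq_gaussianReal (by linarith)]
  have e : 1 - (v - 1) ^ 2 = v ^ 2 * (1 - 2 * (1 - v⁻¹)) := by
    field_simp; ring
  rw [e, Real.sqrt_mul (by positivity), Real.sqrt_sq hv.le, mul_inv]

theorem gaussianReal_eq_withDensity_gaussianRatio {v : ℝ} (hv : 0 < v) :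
    gaussianReal 0 v.toNNReal
      = (gaussianReal 0 1).withDensity fun x => ENNReal.ofReal (gaussianRatio v x) := by
  have hv' : v.toNNReal ≠ 0 := by simpa using hv
  rw [gaussianReal_of_var_ne_zero _ hv', gaussianReal_of_var_ne_zero _ one_ne_zero,
    ← withDensity_mul _ (measurable_gaussianPDF _ _) (measurable_gaussianRatio v).ennreal_ofReal]
  congr 1
  ext x
  rw [Pi.mul_apply, gaussianPDF, gaussianPDF, ← ENNReal.ofReal_mul (gaussianPDFReal_nonneg _ _ _),
    gaussianPDFReal_zero_one, gaussianPDFReal_def, gaussianRatio]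
  simp only [Real.coe_toNNReal _ hv.le, sub_zero]
  congr 1
  rw [Real.sqrt_mul (by positivity), mul_inv]
  have : Real.exp (-x ^ 2 / (2 * v))
      = Real.exp (-(1 / 2) * x ^ 2) * Real.exp ((1 - v⁻¹) / 2 * x ^ 2) := by
    rw [← Real.exp_add]
    congr 1
    field_simp; ring
  rw [this]; ring

/-! ### Spectral identities for symmetric matrices, and Gaussian coordinates in an orthonormal
basis. -/

section Spectral

open Matrix

variable {ι : Type*} [Fintype ι] [DecidableEq ι] {M : Matrix ι ι ℝ}

theorem quadratic_eq_sum_eigenvalues (hM : M.IsHermitian) (x : EuclideanSpace ℝ ι) :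
    ∑ i, ∑ j, M i j * (x i * x j)
      = ∑ k, hM.eigenvalues k * inner ℝ (hM.eigenvectorBasis k) x ^ 2 := by
  have h := hM.eigenvectorBasis.sum_inner_mul_inner x (WithLp.toLp 2 (M *ᵥ x))
  have h1 : inner ℝ x (WithLp.toLp 2 (M *ᵥ x)) = ∑ i, ∑ j, M i j * (x i * x j) := by
    simp only [PiLp.inner_apply, RCLike.inner_apply, conj_trivial, Matrix.mulVec, dotProduct,
      Finset.sum_mul]
    exact Finset.sum_congr rfl fun i _ => Finset.sum_congr rfl fun j _ => by ring
  rw [← h1, ← h]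
  refine Finset.sum_congr rfl fun k _ => ?_
  have h2 : inner ℝ (hM.eigenvectorBasis k) (WithLp.toLp 2 (M *ᵥ x))
      = hM.eigenvalues k * inner ℝ (hM.eigenvectorBasis k) x := by
    have h3 := hM.mulVec_eigenvectorBasis k
    have h4 : ∀ y z : EuclideanSpace ℝ ι, inner ℝ y z = (y : ι → ℝ) ⬝ᵥ z := by
      intro y z
      simp only [PiLp.inner_apply, RCLike.inner_apply, conj_trivial, dotProduct]
      exact Finset.sum_congr rfl fun i _ => by ring
    rw [h4, h4]
    change (hM.eigenvectorBasis k : ι → ℝ) ⬝ᵥ (M *ᵥ x) = _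
    rw [Matrix.dotProduct_mulVec, ← Matrix.mulVec_transpose,
      show Mᵀ = M from by simpa [Matrix.IsHermitian] using hM, h3, smul_dotProduct, smul_eq_mul]
  rw [h2, real_inner_comm]; ring

theorem sum_eigenvalues_eq (hM : M.IsHermitian) : ∑ k, hM.eigenvalues k = ∑ i, M i i := by
  have := hM.trace_eq_sum_eigenvalues
  simpa [Matrix.trace] using this.symm

theorem sum_eigenvalues_sq_eq (hM : M.IsHermitian) :
    ∑ k, hM.eigenvalues k ^ 2 = ∑ i, ∑ j, M i j ^ 2 := by
  have h1 : ∀ i, ∑ j, M i j ^ 2 = ∑ k, (hM.eigenvalues k * hM.eigenvectorBasis k i) ^ 2 := by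
    intro i
    -- Parseval for row `i`, whose coefficient on the `k`-th eigenvector is `(M v_k) i = λ_k v_k i`.
    have h := hM.eigenvectorBasis.sum_sq_inner_right (WithLp.toLp 2 (M i))
    rw [EuclideanSpace.real_norm_sq_eq] at h
    rw [← h]
    refine Finset.sum_congr rfl fun k _ => ?_
    have h3 := congrFun (hM.mulVec_eigenvectorBasis k) i
    congr 1
  simp_rw [h1]
  rw [Finset.sum_comm]
  refine Finset.sum_congr rfl fun k _ => ?_
  have h := EuclideanSpace.real_norm_sq_eq (hM.eigenvectorBasis k)
  rw [hM.eigenvectorBasis.norm_eq_one] at h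
  simp_rw [mul_pow]
  rw [← Finset.mul_sum, ← h]; ring

end Spectral

section OrthonormalCoordinates

variable {ι : Type*} [Fintype ι] {E : Type*} [NormedAddCommGroup E] [InnerProductSpace ℝ E]
  [FiniteDimensional ℝ E] [MeasurableSpace E] [BorelSpace E]

/-- In an orthonormal basis the standard Gaussian has independent standard coordinates. -/
theorem measurePreserving_inner_stdGaussian (b : OrthonormalBasis ι ℝ E) :
    MeasurePreserving (fun (x : E) (k : ι) => inner ℝ (b k) x) (stdGaussian E)
      (Measure.pi fun _ => gaussianReal 0 1) where
  measurable := by fun_prop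
  map_eq := by
    classical
    rw [stdGaussian_eq_map_pi_orthonormalBasis b, Measure.map_map (by fun_prop) (by fun_prop)]
    convert Measure.map_id
    ext x k
    simp [inner_sum, inner_smul_right, b.inner_eq_ite]

end OrthonormalCoordinates

/-! ### Quadratic forms in the pair products and their exponential moments. -/

section PairMatrix

variable {d : ℕ}

/-- The product of the two coordinates of `x` that belong to `I`. -/
noncomputable def pairProd (I : CoordPair d) (x : EuclideanSpace ℝ (Fin d)) : ℝ := ∏ i ∈ I.1, x i

theorem measurable_pairProd (I : CoordPair d) : Measurable (pairProd I) := by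
  unfold pairProd; fun_prop

/-- The symmetric matrix with zero diagonal whose off-diagonal entries are the values of `W`. -/
noncomputable def pairMatrix (W : CoordPair d → ℝ) : Matrix (Fin d) (Fin d) ℝ :=
  Matrix.of fun i j => ∑ I : CoordPair d, if I.1 = {i, j} then W I else 0

theorem ne_of_coordPair_eq {I : CoordPair d} {i j : Fin d} (h : I.1 = {i, j}) : i ≠ j := by
  rintro rfl
  have := I.2
  simp [h] at this

theorem pairProd_eq {I : CoordPair d} {i j : Fin d} (h : I.1 = {i, j})
    (x : EuclideanSpace ℝ (Fin d)) : pairProd I x = x i * x j := by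
  rw [pairProd, h, Finset.prod_pair (ne_of_coordPair_eq h)]

/-- The factor `2` arises since each pair occurs as two ordered pairs. -/
theorem sum_sum_sum_ite_coordPair (G : CoordPair d → ℝ) :
    ∑ i, ∑ j, ∑ I : CoordPair d, (if I.1 = {i, j} then G I else 0) = 2 * ∑ I, G I := by
  have h : ∀ I : CoordPair d, ∑ i, ∑ j, (if I.1 = {i, j} then G I else 0) = 2 * G I := by
    intro I
    obtain ⟨a, b, hab, hI⟩ := Finset.card_eq_two.1 I.2
    rw [← Finset.sum_product' (f := fun i j => if I.1 = {i, j} then G I else 0),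
      ← Finset.sum_filter]
    have : (Finset.univ ×ˢ Finset.univ : Finset (Fin d × Fin d)).filter
        (fun p => I.1 = {p.1, p.2}) = {(a, b), (b, a)} := by
      ext ⟨i, j⟩
      simp only [Finset.mem_filter, Finset.mem_product, Finset.mem_univ, true_and, and_self,
        Finset.mem_insert, Finset.mem_singleton, Prod.mk.injEq, hI]
      rw [← Finset.coe_inj]
      push_cast
      rw [Set.pair_eq_pair_iff]
      constructor
      · rintro (⟨rfl, rfl⟩ | ⟨rfl, rfl⟩) <;> simp
      · rintro (⟨rfl, rfl⟩ | ⟨rfl, rfl⟩) <;> simp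
    rw [this, Finset.sum_pair (by simpa using fun h _ => hab h)]
    ring
  rw [Finset.mul_sum, Finset.sum_congr rfl fun i _ => Finset.sum_comm, Finset.sum_comm]
  exact Finset.sum_congr rfl fun I _ => h I

theorem pairMatrix_isHermitian (W : CoordPair d → ℝ) : (pairMatrix W).IsHermitian := by
  ext i j
  simp [pairMatrix, Finset.pair_comm]

theorem pairMatrix_diag (W : CoordPair d → ℝ) (i : Fin d) : pairMatrix W i i = 0 := by
  rw [pairMatrix, Matrix.of_apply]
  exact Finset.sum_eq_zero fun I _ => if_neg fun h => ne_of_coordPair_eq h rfl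

theorem sum_pairMatrix_mul (W : CoordPair d → ℝ) (x : EuclideanSpace ℝ (Fin d)) :
    ∑ i, ∑ j, pairMatrix W i j * (x i * x j) = 2 * ∑ I, W I * pairProd I x := by
  rw [← sum_sum_sum_ite_coordPair]
  refine Finset.sum_congr rfl fun i _ => Finset.sum_congr rfl fun j _ => ?_
  rw [pairMatrix, Matrix.of_apply, Finset.sum_mul]
  refine Finset.sum_congr rfl fun I _ => ?_
  split_ifs with h
  · rw [pairProd_eq h]
  · simp

theorem sum_pairMatrix_sq (W : CoordPair d → ℝ) :
    ∑ i, ∑ j, pairMatrix W i j ^ 2 = 2 * ∑ I, W I ^ 2 := by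
  rw [← sum_sum_sum_ite_coordPair]
  refine Finset.sum_congr rfl fun i _ => Finset.sum_congr rfl fun j _ => ?_
  rw [pairMatrix, Matrix.of_apply]
  by_cases h : ∃ J : CoordPair d, J.1 = {i, j}
  · obtain ⟨J, hJ⟩ := h
    have hu : ∀ I : CoordPair d, I.1 = {i, j} ↔ I = J := fun I => by
      rw [← hJ]; exact Subtype.ext_iff.symm
    simp [hu]
  · push Not at h
    simp [h]

theorem sum_pairMatrix_eigenvalues (W : CoordPair d → ℝ) :
    ∑ k, (pairMatrix_isHermitian W).eigenvalues k = 0 := by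
  simp [sum_eigenvalues_eq, pairMatrix_diag]

theorem sum_pairMatrix_eigenvalues_sq (W : CoordPair d → ℝ) :
    ∑ k, (pairMatrix_isHermitian W).eigenvalues k ^ 2 = 2 * ∑ I, W I ^ 2 := by
  rw [sum_eigenvalues_sq_eq, sum_pairMatrix_sq]

theorem inv_sqrt_one_sub_le {a : ℝ} (ha : |a| ≤ 1 / 4) :
    (√(1 - 2 * a))⁻¹ ≤ Real.exp (a + 4 * a ^ 2) := by
  obtain ⟨h1, h2⟩ := abs_le.1 ha
  have hp : 0 < 1 - 2 * a := by linarith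
  have h3 := exp_sub_two_sq_le (x := -(2 * a)) (by rw [abs_neg, abs_mul]; norm_num; linarith)
  rw [inv_le_comm₀ (Real.sqrt_pos.2 hp) (Real.exp_pos _), ← Real.exp_neg]
  apply Real.le_sqrt_of_sq_le
  rw [← Real.exp_nat_mul]
  calc _ = Real.exp (-(2 * a) - 2 * (-(2 * a)) ^ 2) := by congr 1; push_cast; ring
    _ ≤ _ := h3
    _ = _ := by ring

theorem exp_sum_pairProd_eq (W : CoordPair d → ℝ) (x : EuclideanSpace ℝ (Fin d)) :
    Real.exp (∑ I, W I * pairProd I x) = ∏ k, Real.exp ((pairMatrix_isHermitian W).eigenvalues k / 2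
      * inner ℝ ((pairMatrix_isHermitian W).eigenvectorBasis k) x ^ 2) := by
  have h := quadratic_eq_sum_eigenvalues (pairMatrix_isHermitian W) x
  rw [sum_pairMatrix_mul] at h
  rw [← Real.exp_sum]
  congr 1
  have : ∀ k, (pairMatrix_isHermitian W).eigenvalues k / 2
      * inner ℝ ((pairMatrix_isHermitian W).eigenvectorBasis k) x ^ 2
      = ((pairMatrix_isHermitian W).eigenvalues k
      * inner ℝ ((pairMatrix_isHermitian W).eigenvectorBasis k) x ^ 2) / 2 := fun k => by ring
  simp_rw [this, ← Finset.sum_div, ← h]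
  ring

/-- The threshold `1/8` makes the squared Frobenius norm `2 ∑ W²` at most `1/4`, which keeps the
Gaussian exponents `λ/2` safely below `1/2`. -/
theorem abs_pairMatrix_eigenvalue_le {W : CoordPair d → ℝ} (hW : ∑ I, W I ^ 2 ≤ 1 / 8)
    (k : Fin d) : |(pairMatrix_isHermitian W).eigenvalues k / 2| ≤ 1 / 4 := by
  apply abs_le_of_sq_le_sq _ (by norm_num)
  have := Finset.single_le_sum (f := fun k => (pairMatrix_isHermitian W).eigenvalues k ^ 2)
    (fun i _ => sq_nonneg _) (Finset.mem_univ k)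
  rw [sum_pairMatrix_eigenvalues_sq] at this
  linarith

theorem integrable_exp_sum_pairProd {W : CoordPair d → ℝ} (hW : ∑ I, W I ^ 2 ≤ 1 / 8) :
    Integrable (fun x => Real.exp (∑ I, W I * pairProd I x))
      (stdGaussian (EuclideanSpace ℝ (Fin d))) := by
  simp_rw [exp_sum_pairProd_eq]
  refine (measurePreserving_inner_stdGaussian
    (pairMatrix_isHermitian W).eigenvectorBasis).integrable_comp_of_integrable
    (g := fun y => ∏ k, Real.exp ((pairMatrix_isHermitian W).eigenvalues k / 2 * y k ^ 2)) ?_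
  refine Integrable.fintype_prod_dep fun k => integrable_exp_mul_sq_gaussianReal ?_
  linarith [(abs_le.1 (abs_pairMatrix_eigenvalue_le hW k)).2]

/-- The moment generating function of a quadratic form with zero diagonal. -/
theorem integral_exp_sum_pairProd_le {W : CoordPair d → ℝ} (hW : ∑ I, W I ^ 2 ≤ 1 / 8) :
    ∫ x, Real.exp (∑ I, W I * pairProd I x) ∂(stdGaussian (EuclideanSpace ℝ (Fin d)))
      ≤ Real.exp (2 * ∑ I, W I ^ 2) := by
  simp_rw [exp_sum_pairProd_eq]
  have hmp := measurePreserving_inner_stdGaussian (pairMatrix_isHermitian W).eigenvectorBasis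
  have hm : Measurable fun y : Fin d → ℝ =>
    ∏ k, Real.exp ((pairMatrix_isHermitian W).eigenvalues k / 2 * y k ^ 2) := by fun_prop
  have h := integral_map (μ := stdGaussian (EuclideanSpace ℝ (Fin d))) hmp.measurable.aemeasurable
    hm.aestronglyMeasurable
  rw [hmp.map_eq] at h
  rw [← h, integral_fintype_prod_eq_prod (μ := fun _ : Fin d => gaussianReal 0 1)
    (f := fun k y => Real.exp ((pairMatrix_isHermitian W).eigenvalues k / 2 * y ^ 2))]
  calc _ ≤ ∏ k, Real.exp ((pairMatrix_isHermitian W).eigenvalues k / 2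
        + 4 * ((pairMatrix_isHermitian W).eigenvalues k / 2) ^ 2) := by
        refine Finset.prod_le_prod (fun k _ => integral_nonneg fun x => (Real.exp_pos _).le) ?_
        intro k _
        have hk := abs_pairMatrix_eigenvalue_le hW k
        rw [integral_exp_mul_sq_gaussianReal (by linarith [(abs_le.1 hk).2])]
        exact inv_sqrt_one_sub_le hk
    _ = Real.exp (2 * ∑ I, W I ^ 2) := by
        -- The linear terms cancel because the trace is zero. Only the Frobenius norm remains, as
        -- for a Gaussian variable.
        rw [← Real.exp_sum]
        congr 1
        have : ∀ k, (pairMatrix_isHermitian W).eigenvalues k / 2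
          + 4 * ((pairMatrix_isHermitian W).eigenvalues k / 2) ^ 2
          = (pairMatrix_isHermitian W).eigenvalues k / 2
            + (pairMatrix_isHermitian W).eigenvalues k ^ 2 := fun k => by ring
        simp_rw [this, Finset.sum_add_distrib, ← Finset.sum_div, sum_pairMatrix_eigenvalues,
          sum_pairMatrix_eigenvalues_sq]
        ring

end PairMatrix

/-! ### Density of the correlated Gaussian relative to the standard one, and its moments. -/

section PairDensity

variable {d : ℕ}

/-- The covariance matrix of `pairGaussian` minus the identity. -/
noncomputable abbrev pairPerturbation (I : CoordPair d) (σ : ℝ) : Matrix (Fin d) (Fin d) ℝ :=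
  pairMatrix (Pi.single I σ)

/-- The eigenvalues of `pairPerturbation`. -/
noncomputable abbrev pairEigenvalue (I : CoordPair d) (σ : ℝ) : Fin d → ℝ :=
  (pairMatrix_isHermitian (Pi.single I σ)).eigenvalues

/-- An orthonormal basis of eigenvectors of `pairPerturbation`. -/
noncomputable abbrev pairBasis (I : CoordPair d) (σ : ℝ) :
    OrthonormalBasis (Fin d) ℝ (EuclideanSpace ℝ (Fin d)) :=
  (pairMatrix_isHermitian (Pi.single I σ)).eigenvectorBasis

theorem pairCovariance_apply (I : CoordPair d) (σ : ℝ) (i j : Fin d) :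
    pairCovariance I σ i j = (if i = j then 1 else 0) + pairPerturbation I σ i j := by
  have h : pairPerturbation I σ i j = if I.1 = {i, j} then σ else 0 := by
    rw [pairPerturbation, pairMatrix, Matrix.of_apply, Finset.sum_eq_single I]
    · simp
    · intro J _ hJ
      simp [hJ]
    · simp
  rw [h, pairCovariance, Matrix.of_apply]
  split_ifs with h1 h2 h2
  · exact absurd h1 (ne_of_coordPair_eq h2)
  all_goals simp

theorem sum_pairEigenvalue_sq (I : CoordPair d) (σ : ℝ) :
    ∑ k, pairEigenvalue I σ k ^ 2 = 2 * σ ^ 2 := by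
  rw [sum_pairMatrix_eigenvalues_sq]
  congr 1
  rw [Finset.sum_eq_single I]
  · simp
  · intro J _ hJ
    simp [hJ]
  · simp

theorem pairEigenvalue_sq_le (I : CoordPair d) (σ : ℝ) (k : Fin d) :
    pairEigenvalue I σ k ^ 2 ≤ 2 * σ ^ 2 := by
  rw [← sum_pairEigenvalue_sq I]
  exact Finset.single_le_sum (f := fun k => pairEigenvalue I σ k ^ 2)
    (fun i _ => sq_nonneg _) (Finset.mem_univ k)

theorem abs_pairEigenvalue_lt {σ : ℝ} (hσ : 2 * σ ^ 2 < 1) (I : CoordPair d) (k : Fin d) :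
    |pairEigenvalue I σ k| < 1 := by
  apply abs_lt_of_sq_lt_sq _ zero_le_one
  linarith [pairEigenvalue_sq_le I σ k]

theorem dotProduct_pairCovariance (I : CoordPair d) (σ : ℝ) (x : EuclideanSpace ℝ (Fin d)) :
    dotProduct (x : Fin d → ℝ) ((pairCovariance I σ).mulVec x)
      = ∑ k, (1 + pairEigenvalue I σ k) * inner ℝ (pairBasis I σ k) x ^ 2 := by
  have h := quadratic_eq_sum_eigenvalues (pairMatrix_isHermitian (Pi.single I σ)) x
  have h2 := (pairBasis I σ).sum_sq_inner_right x
  rw [EuclideanSpace.real_norm_sq_eq] at h2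
  simp_rw [add_mul, one_mul, Finset.sum_add_distrib, h2, ← h, ← Finset.sum_add_distrib]
  simp only [dotProduct, Matrix.mulVec, pairCovariance_apply, add_mul, Finset.sum_add_distrib,
    mul_add, Finset.mul_sum]
  congr 1
  · refine Finset.sum_congr rfl fun i _ => ?_
    simp [sq]
  · exact Finset.sum_congr rfl fun i _ => Finset.sum_congr rfl fun j _ => by ring

theorem pairCovariance_posSemidef {σ : ℝ} (hσ : 2 * σ ^ 2 < 1) (I : CoordPair d) :
    (pairCovariance I σ).PosSemidef := by
  refine Matrix.PosSemidef.of_dotProduct_mulVec_nonneg ?_ fun x => ?_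
  · ext i j
    simp [pairCovariance, Finset.pair_comm, eq_comm]
  · have := dotProduct_pairCovariance I σ (WithLp.toLp 2 x)
    simp only [star_trivial]
    rw [this]
    refine Finset.sum_nonneg fun k _ => mul_nonneg ?_ (sq_nonneg _)
    linarith [(abs_lt.1 (abs_pairEigenvalue_lt hσ I k)).1]

/-- The density of `pairGaussian` relative to the standard Gaussian distribution. -/
noncomputable def pairDensity (I : CoordPair d) (σ : ℝ) (x : EuclideanSpace ℝ (Fin d)) : ℝ :=
  ∏ k, gaussianRatio (1 + pairEigenvalue I σ k) (inner ℝ (pairBasis I σ k) x)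

theorem pairDensity_nonneg (I : CoordPair d) (σ : ℝ) (x : EuclideanSpace ℝ (Fin d)) :
    0 ≤ pairDensity I σ x :=
  Finset.prod_nonneg fun _ _ => gaussianRatio_nonneg _ _

theorem measurable_pairDensity (I : CoordPair d) (σ : ℝ) : Measurable (pairDensity I σ) := by
  unfold pairDensity
  exact Finset.measurable_prod _ fun k _ => (measurable_gaussianRatio _).comp (by fun_prop)

instance isProbabilityMeasure_pairGaussian (I : CoordPair d) (σ : ℝ) :
    IsProbabilityMeasure (pairGaussian d σ I) := by
  unfold pairGaussian; infer_instance

/-- Diagonalizing the covariance turns the law into independent Gaussians along the eigenvectors.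
Both sides have the same characteristic function. -/
theorem pairGaussian_eq_map_pi {σ : ℝ} (hσ : 2 * σ ^ 2 < 1) (I : CoordPair d) :
    pairGaussian d σ I =
      (Measure.pi fun k => gaussianReal 0 (1 + pairEigenvalue I σ k).toNNReal).map
        (fun y => ∑ k, y k • pairBasis I σ k) := by
  have : IsProbabilityMeasure
      ((Measure.pi fun k => gaussianReal 0 (1 + pairEigenvalue I σ k).toNNReal).map
        (fun y => ∑ k, y k • pairBasis I σ k)) :=
    Measure.isProbabilityMeasure_map (Measurable.aemeasurable (by fun_prop))
  rw [pairGaussian]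
  apply Measure.ext_of_charFun
  ext t
  rw [charFun_multivariateGaussian (pairCovariance_posSemidef hσ I), charFun_apply,
    integral_map (Measurable.aemeasurable (by fun_prop))
    (Measurable.aestronglyMeasurable (by fun_prop))]
  simp_rw [sum_inner, Complex.ofReal_sum, Finset.sum_mul, Complex.exp_sum]
  rw [integral_fintype_prod_eq_prod
    (f := fun k (y : ℝ) => Complex.exp (inner ℝ (y • pairBasis I σ k) t * Complex.I))]
  simp_rw [real_inner_smul_left, mul_comm _ (inner ℝ _ t), Complex.ofReal_mul,
    ← charFun_apply_real, charFun_gaussianReal]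
  rw [← Complex.exp_sum]
  have hk : ∀ k, ((1 + pairEigenvalue I σ k).toNNReal : ℝ) = 1 + pairEigenvalue I σ k := fun k =>
    Real.coe_toNNReal _ (by linarith [(abs_lt.1 (abs_pairEigenvalue_lt hσ I k)).1])
  have h := dotProduct_pairCovariance I σ t
  congr 1
  simp only [inner_zero_right, Complex.ofReal_zero, zero_mul, mul_zero, zero_sub,
    Finset.sum_neg_distrib, ← Finset.sum_div]
  congr 2
  rw [h]
  push_cast
  refine Finset.sum_congr rfl fun k _ => ?_
  have h2 : (((1 + pairEigenvalue I σ k).toNNReal : ℝ) : ℂ) = 1 + pairEigenvalue I σ k := by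
    rw [hk k]; push_cast; rfl
  rw [h2]

theorem pairGaussian_eq_withDensity {σ : ℝ} (hσ : 2 * σ ^ 2 < 1) (I : CoordPair d) :
    pairGaussian d σ I = (stdGaussian (EuclideanSpace ℝ (Fin d))).withDensity
      fun x => ENNReal.ofReal (pairDensity I σ x) := by
  have hpos : ∀ k, 0 < 1 + pairEigenvalue I σ k := fun k => by
    linarith [(abs_lt.1 (abs_pairEigenvalue_lt hσ I k)).1]
  have hU : Measurable fun y : Fin d → ℝ => ∑ k, y k • pairBasis I σ k := by fun_prop
  have hmp : MeasurePreserving (fun y : Fin d → ℝ => ∑ k, y k • pairBasis I σ k)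
      (Measure.pi fun _ => gaussianReal 0 1) (stdGaussian (EuclideanSpace ℝ (Fin d))) :=
    ⟨hU, (stdGaussian_eq_map_pi_orthonormalBasis _).symm⟩
  have hpi : Measure.pi (fun k => gaussianReal 0 (1 + pairEigenvalue I σ k).toNNReal)
      = (Measure.pi fun _ : Fin d => gaussianReal 0 1).withDensity fun y =>
        ENNReal.ofReal (∏ k, gaussianRatio (1 + pairEigenvalue I σ k) (y k)) :=
    pi_eq_withDensity_prod (μ := fun _ : Fin d => gaussianReal 0 1)
      (f := fun k => gaussianRatio (1 + pairEigenvalue I σ k))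
      (fun k => integrable_gaussianRatio (hpos k)) (fun k => gaussianRatio_nonneg _)
      (fun k => gaussianReal_eq_withDensity_gaussianRatio (hpos k))
  rw [pairGaussian_eq_map_pi hσ, hpi]
  ext s hs
  rw [Measure.map_apply hU hs, withDensity_apply _ (hU hs), withDensity_apply _ hs,
    ← hmp.setLIntegral_comp_preimage hs (measurable_pairDensity I σ).ennreal_ofReal]
  simp only [pairDensity, inner_sum, inner_smul_right, (pairBasis I σ).inner_eq_ite]
  simp

theorem integrable_pairDensity_sq {σ : ℝ} (hσ : 2 * σ ^ 2 < 1) (I : CoordPair d) :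
    Integrable (fun x => pairDensity I σ x ^ 2) (stdGaussian (EuclideanSpace ℝ (Fin d))) := by
  have hk : ∀ k : Fin d, Integrable (fun y => gaussianRatio (1 + pairEigenvalue I σ k) y ^ 2)
      (gaussianReal 0 1) := fun k => by
    obtain ⟨h1, h2⟩ := abs_lt.1 (abs_pairEigenvalue_lt hσ I k)
    exact integrable_gaussianRatio_sq (by linarith) (by linarith)
  have h := Integrable.fintype_prod_dep (μ := fun _ : Fin d => gaussianReal 0 1) hk
  have h2 := (measurePreserving_inner_stdGaussian (pairBasis I σ)).integrable_comp_of_integrable h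
  refine h2.congr (ae_of_all _ fun x => ?_)
  simp only [Function.comp_apply, pairDensity, Finset.prod_pow]

theorem one_sub_sum_le_prod_one_sub {ι : Type*} (s : Finset ι) {a : ι → ℝ} (h0 : ∀ i, 0 ≤ a i)
    (h1 : ∀ i, a i ≤ 1) : 1 - ∑ i ∈ s, a i ≤ ∏ i ∈ s, (1 - a i) := by
  classical
  induction s using Finset.induction_on with
  | empty => simp
  | insert i s hi ih =>
    rw [Finset.sum_insert hi, Finset.prod_insert hi]
    have hp : 0 ≤ ∏ i ∈ s, (1 - a i) := Finset.prod_nonneg fun i _ => by linarith [h1 i]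
    have hp1 : ∏ i ∈ s, (1 - a i) ≤ 1 :=
      Finset.prod_le_one (fun i _ => by linarith [h1 i]) fun i _ => by linarith [h0 i]
    nlinarith [h0 i]

/-- The integral is `∏ (1 - λ_k²)^(-1/2)`, and `∏ (1 - λ_k²) ≥ 1 - ∑ λ_k² = 1 - 2 σ²`. Only the
Frobenius norm is used, so the eigenvalues need not be found. -/
theorem integral_pairDensity_sq_le {σ : ℝ} (hσ : 2 * σ ^ 2 < 1) (I : CoordPair d) :
    ∫ x, pairDensity I σ x ^ 2 ∂(stdGaussian (EuclideanSpace ℝ (Fin d)))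
      ≤ (√(1 - 2 * σ ^ 2))⁻¹ := by
  have hmp := measurePreserving_inner_stdGaussian (pairBasis I σ)
  have hm : Measurable fun y : Fin d → ℝ =>
      ∏ k, gaussianRatio (1 + pairEigenvalue I σ k) (y k) ^ 2 :=
    Finset.measurable_prod _ fun k _ =>
      ((measurable_gaussianRatio _).comp (measurable_pi_apply k)).pow_const 2
  have h := integral_map (μ := stdGaussian (EuclideanSpace ℝ (Fin d))) hmp.measurable.aemeasurable
    hm.aestronglyMeasurable
  rw [hmp.map_eq] at h
  simp_rw [pairDensity, ← Finset.prod_pow]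
  rw [← h, integral_fintype_prod_eq_prod (μ := fun _ : Fin d => gaussianReal 0 1)
    (f := fun k y => gaussianRatio (1 + pairEigenvalue I σ k) y ^ 2)]
  have hk : ∀ k, ∫ x, gaussianRatio (1 + pairEigenvalue I σ k) x ^ 2 ∂(gaussianReal 0 1)
      = (√(1 - pairEigenvalue I σ k ^ 2))⁻¹ := by
    intro k
    obtain ⟨h1, h2⟩ := abs_lt.1 (abs_pairEigenvalue_lt hσ I k)
    rw [integral_gaussianRatio_sq (by linarith) (by linarith), add_sub_cancel_left]
  have hle : ∀ k, pairEigenvalue I σ k ^ 2 ≤ 1 := fun k => by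
    linarith [pairEigenvalue_sq_le I σ k]
  simp_rw [hk, Finset.prod_inv_distrib]
  rw [← Real.sqrt_prod _ fun k _ => by linarith [hle k]]
  have hp : 0 < 1 - 2 * σ ^ 2 := by linarith
  gcongr
  rw [← sum_pairEigenvalue_sq I]
  exact one_sub_sum_le_prod_one_sub _ (fun k => sq_nonneg _) hle

theorem integral_pairProd_pairGaussian {σ : ℝ} (hσ : 2 * σ ^ 2 < 1) (I : CoordPair d) :
    ∫ x, pairProd I x ∂(pairGaussian d σ I) = σ := by
  obtain ⟨i, j, hij, hI⟩ := Finset.card_eq_two.1 I.2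
  have hS := pairCovariance_posSemidef hσ I
  have h := covariance_eval_multivariateGaussian (μ := 0) hS i j
  have hmem : ∀ i, MemLp (fun x : EuclideanSpace ℝ (Fin d) => x i) 2 (pairGaussian d σ I) := by
    intro i
    have := (measurePreserving_eval_multivariateGaussian (μ := 0) hS (i := i))
    exact (memLp_id_gaussianReal' 2 (by simp)).comp_measurePreserving this
  have hmean : ∀ i, ∫ x : EuclideanSpace ℝ (Fin d), x i ∂(pairGaussian d σ I) = 0 := by
    intro i
    have h1 := (measurePreserving_eval_multivariateGaussian (μ := 0) hS (i := i))
    have h2 := integral_map (μ := pairGaussian d σ I) h1.measurable.aemeasurable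
      (f := fun y : ℝ => y) (by fun_prop)
    rw [← h2, pairGaussian, h1.map_eq, integral_id_gaussianReal]
    simp
  rw [← pairGaussian, covariance_eq_sub (hmem i) (hmem j), hmean, zero_mul, sub_zero] at h
  simp_rw [pairProd_eq hI]
  refine h.trans ?_
  rw [pairCovariance, Matrix.of_apply, if_neg hij, if_pos hI]

theorem memLp_pairProd_and_moments (I : CoordPair d) :
    MemLp (pairProd I) 2 (stdGaussian (EuclideanSpace ℝ (Fin d)))
      ∧ ∫ x, pairProd I x ∂(stdGaussian (EuclideanSpace ℝ (Fin d))) = 0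
      ∧ ∫ x, pairProd I x ^ 2 ∂(stdGaussian (EuclideanSpace ℝ (Fin d))) = 1 := by
  have hmp : MeasurePreserving (WithLp.toLp 2) (Measure.pi fun _ => gaussianReal 0 1)
      (stdGaussian (EuclideanSpace ℝ (Fin d))) := ⟨by fun_prop, map_pi_eq_stdGaussian⟩
  have hm := measurable_pairProd I
  have hprod : ∀ x : Fin d → ℝ, pairProd I (WithLp.toLp 2 x)
      = ∏ i, (if i ∈ I.1 then x i else 1) := fun x => by
    rw [pairProd, Finset.prod_ite_mem]; simp
  have hprod2 : ∀ x : Fin d → ℝ, pairProd I (WithLp.toLp 2 x) ^ 2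
      = ∏ i, (if i ∈ I.1 then x i ^ 2 else 1) := fun x => by
    rw [hprod, ← Finset.prod_pow]
    exact Finset.prod_congr rfl fun i _ => by split_ifs <;> simp
  have hsq : ∫ x, x ^ 2 ∂(gaussianReal 0 1) = 1 := by
    have h := variance_fun_id_gaussianReal (μ := 0) (v := 1)
    rw [variance_of_integral_eq_zero (by fun_prop) integral_id_gaussianReal] at h
    simpa using h
  have hisq : Integrable (fun x : ℝ => x ^ 2) (gaussianReal 0 1) :=
    (memLp_id_gaussianReal' (μ := 0) (v := 1) 2 (by simp)).integrable_sq
  refine ⟨?_, ?_, ?_⟩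
  · rw [memLp_two_iff_integrable_sq hm.aestronglyMeasurable, ← hmp.map_eq,
      integrable_map_measure (hm.pow_const 2).aestronglyMeasurable hmp.measurable.aemeasurable]
    simp only [Function.comp_def, hprod2]
    refine Integrable.fintype_prod_dep (f := fun i (x : ℝ) => if i ∈ I.1 then x ^ 2 else 1)
      fun i => ?_
    split_ifs
    exacts [hisq, integrable_const _]
  · rw [← hmp.map_eq, integral_map hmp.measurable.aemeasurable hm.aestronglyMeasurable]
    simp only [hprod]
    rw [integral_fintype_prod_eq_prod (μ := fun _ : Fin d => gaussianReal 0 1)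
      (f := fun i (x : ℝ) => if i ∈ I.1 then x else 1)]
    obtain ⟨i, hi⟩ : I.1.Nonempty := Finset.card_pos.1 (by rw [I.2]; norm_num)
    exact Finset.prod_eq_zero (Finset.mem_univ i) (by simp [hi])
  · rw [← hmp.map_eq, integral_map hmp.measurable.aemeasurable
      (hm.pow_const 2).aestronglyMeasurable]
    simp only [hprod2]
    rw [integral_fintype_prod_eq_prod (μ := fun _ : Fin d => gaussianReal 0 1)
      (f := fun i (x : ℝ) => if i ∈ I.1 then x ^ 2 else 1)]
    exact Finset.prod_eq_one fun i _ => by split_ifs <;> simp [hsq]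

end PairDensity

/-! ### Averages over events: Jensen and Bessel inequalities. -/

section SetAverage

variable {Ω : Type*} [MeasurableSpace Ω] {P : Measure Ω}

theorem setIntegral_sq_le [IsFiniteMeasure P] {f : Ω → ℝ} (hf : MemLp f 2 P) (s : Set Ω) :
    (∫ x in s, f x ∂P) ^ 2 ≤ P.real s * ∫ x in s, f x ^ 2 ∂P := by
  have hf2 := hf.integrable_sq.integrableOn (s := s)
  have hf1 := (hf.integrable one_le_two).integrableOn (s := s)
  by_cases hp : P.real s = 0
  · have h0 : P s = 0 := by simpa [Measure.real, ENNReal.toReal_eq_zero_iff] using hp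
    simp [Measure.restrict_eq_zero.2 h0]
  have hp' : 0 < P.real s := lt_of_le_of_ne measureReal_nonneg (Ne.symm hp)
  set c := (∫ x in s, f x ∂P) / P.real s with hc
  have h : 0 ≤ ∫ x in s, (f x - c) ^ 2 ∂P := integral_nonneg fun x => sq_nonneg _
  have e : ∀ x, (f x - c) ^ 2 = f x ^ 2 - 2 * c * f x + c ^ 2 := fun x => by ring
  simp_rw [e] at h
  have e2 : ∫ x in s, (f x ^ 2 - 2 * c * f x + c ^ 2) ∂P
      = ∫ x in s, f x ^ 2 ∂P - 2 * c * ∫ x in s, f x ∂P + P.real s * c ^ 2 := by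
    rw [integral_add, integral_sub, integral_const_mul, setIntegral_const, smul_eq_mul]
    · exact hf2
    · exact hf1.const_mul _
    · exact hf2.sub (hf1.const_mul _)
    · exact integrable_const _
  rw [e2] at h
  have hI : ∫ x in s, f x ∂P = c * P.real s := by rw [hc]; field_simp
  rw [hI] at h ⊢
  nlinarith

/-- Jensen's inequality for the exponential function on a set of positive measure. -/
theorem mul_exp_setAverage_le [IsFiniteMeasure P] {f : Ω → ℝ} {s : Set Ω} (hp : 0 < P.real s)
    (hf : IntegrableOn f s P) (hexp : Integrable (fun x => Real.exp (f x)) P) :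
    P.real s * Real.exp ((∫ x in s, f x ∂P) / P.real s) ≤ ∫ x, Real.exp (f x) ∂P := by
  set c := (∫ x in s, f x ∂P) / P.real s with hc
  have hI : ∫ x in s, f x ∂P = c * P.real s := by rw [hc]; field_simp
  -- The integrand is the tangent line of `exp` at the mean `c`.
  calc P.real s * Real.exp c = ∫ x in s, Real.exp c * (f x - c + 1) ∂P := by
        rw [integral_const_mul, integral_add, integral_sub, hI, setIntegral_const,
          setIntegral_const, smul_eq_mul, smul_eq_mul]
        · ring
        · exact hf
        · exact integrable_const _
        · exact hf.sub (integrable_const _)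
        · exact integrable_const _
    _ ≤ ∫ x in s, Real.exp (f x) ∂P := by
        refine integral_mono (((hf.sub (integrable_const _)).add (integrable_const _)).const_mul _)
          hexp.integrableOn fun x => ?_
        calc Real.exp c * (f x - c + 1) ≤ Real.exp c * Real.exp (f x - c) := by
              gcongr; exact Real.add_one_le_exp _
          _ = Real.exp (f x) := by rw [← Real.exp_add]; congr 1; ring
    _ ≤ ∫ x, Real.exp (f x) ∂P :=
        setIntegral_le_integral hexp (ae_of_all _ fun x => (Real.exp_pos _).le)

/-- Bessel's inequality for the averages over one factor of the cells of a rectangular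
partition. -/
theorem sum_prod_mul_setAverage_sq_le {κ Γ : Type*} [Fintype κ] [DecidableEq κ] [Fintype Γ]
    {A : κ → Γ → Set Ω} [IsProbabilityMeasure P] (hA : ∀ j π, MeasurableSet (A j π))
    (hpart : ∀ x : κ → Ω, ∃! π, ∀ j, x j ∈ A j π) (j : κ) {f : Ω → ℝ} (hf : MemLp f 2 P) :
    ∑ π, (∏ i, P.real (A i π)) * ((∫ x in A j π, f x ∂P) / P.real (A j π)) ^ 2
      ≤ ∫ x, f x ^ 2 ∂P := by
  have hf2 := hf.integrable_sq
  have hfin : IsFiniteMeasure (P.withDensity fun x => ENNReal.ofReal (f x ^ 2)) :=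
    isFiniteMeasure_withDensity_ofReal hf2.2
  have hν : ∀ s, MeasurableSet s →
      (P.withDensity fun x => ENNReal.ofReal (f x ^ 2)).real s = ∫ x in s, f x ^ 2 ∂P := by
    intro s hs
    rw [Measure.real, withDensity_apply _ hs, ← ofReal_integral_eq_lintegral_ofReal
      hf2.integrableOn (ae_of_all _ fun x => sq_nonneg _), ENNReal.toReal_ofReal]
    exact integral_nonneg fun x => sq_nonneg _
  have h := sum_measureReal_mul_prod_erase hA hpart P
    (P.withDensity fun x => ENNReal.ofReal (f x ^ 2)) j
  rw [hν _ MeasurableSet.univ, setIntegral_univ] at h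
  rw [← h]
  refine Finset.sum_le_sum fun π _ => ?_
  rw [hν _ (hA j π), ← Finset.mul_prod_erase Finset.univ _ (Finset.mem_univ j), mul_right_comm]
  refine mul_le_mul_of_nonneg_right ?_ (Finset.prod_nonneg fun i _ => measureReal_nonneg)
  have hs := setIntegral_sq_le hf (A j π)
  by_cases hp : P.real (A j π) = 0
  · rw [hp, zero_mul]
    exact integral_nonneg fun x => sq_nonneg _
  have hp' : 0 < P.real (A j π) := lt_of_le_of_ne measureReal_nonneg (Ne.symm hp)
  rw [div_pow, ← mul_div_assoc, div_le_iff₀ (by positivity)]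
  nlinarith

end SetAverage

/-! ### Blocks of points: density, empirical correlations, and averages over an event. -/

section Block

variable {d m : ℕ}

/-- The distribution of a block of `m` independent standard Gaussian points. -/
noncomputable abbrev nullBlock (d m : ℕ) : Measure (Fin m → EuclideanSpace ℝ (Fin d)) :=
  Measure.pi fun _ => stdGaussian (EuclideanSpace ℝ (Fin d))

/-- The distribution of a block of `m` independent points with a correlated pair. -/
noncomputable abbrev pairBlock (d m : ℕ) (σ : ℝ) (I : CoordPair d) :
    Measure (Fin m → EuclideanSpace ℝ (Fin d)) :=
  Measure.pi fun _ => pairGaussian d σ I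

/-- The density of `pairBlock` relative to `nullBlock`. -/
noncomputable def blockDensity (I : CoordPair d) (σ : ℝ)
    (y : Fin m → EuclideanSpace ℝ (Fin d)) : ℝ := ∏ a, pairDensity I σ (y a)

/-- The empirical correlation of a pair of coordinates in a block of points. -/
noncomputable def blockCorr (I : CoordPair d) (y : Fin m → EuclideanSpace ℝ (Fin d)) : ℝ :=
  ∑ a, pairProd I (y a)

theorem blockDensity_nonneg (I : CoordPair d) (σ : ℝ) (y : Fin m → EuclideanSpace ℝ (Fin d)) :
    0 ≤ blockDensity I σ y := Finset.prod_nonneg fun _ _ => pairDensity_nonneg _ _ _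

theorem measurable_blockDensity (I : CoordPair d) (σ : ℝ) :
    Measurable (blockDensity (m := m) I σ) :=
  Finset.measurable_prod _ fun a _ => (measurable_pairDensity I σ).comp (measurable_pi_apply a)

theorem measurable_blockCorr (I : CoordPair d) : Measurable (blockCorr (m := m) I) :=
  Finset.measurable_sum _ fun a _ => (measurable_pairProd I).comp (measurable_pi_apply a)

theorem memLp_pairDensity {σ : ℝ} (hσ : 2 * σ ^ 2 < 1) (I : CoordPair d) :
    MemLp (pairDensity I σ) 2 (stdGaussian (EuclideanSpace ℝ (Fin d))) :=
  (memLp_two_iff_integrable_sq (measurable_pairDensity I σ).aestronglyMeasurable).2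
    (integrable_pairDensity_sq hσ I)

theorem pairBlock_eq_withDensity {σ : ℝ} (hσ : 2 * σ ^ 2 < 1) (I : CoordPair d) :
    pairBlock d m σ I
      = (nullBlock d m).withDensity fun y => ENNReal.ofReal (blockDensity I σ y) :=
  pi_eq_withDensity_prod (μ := fun _ : Fin m => stdGaussian (EuclideanSpace ℝ (Fin d)))
    (f := fun _ => pairDensity I σ)
    (fun _ => (memLp_pairDensity hσ I).integrable one_le_two) (fun _ => pairDensity_nonneg I σ)
    (fun _ => pairGaussian_eq_withDensity hσ I)

theorem pairBlock_absolutelyContinuous {σ : ℝ} (hσ : 2 * σ ^ 2 < 1) (I : CoordPair d) :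
    pairBlock d m σ I ≪ nullBlock d m := by
  rw [pairBlock_eq_withDensity hσ]
  exact withDensity_absolutelyContinuous _ _

theorem integrable_blockDensity_sq {σ : ℝ} (hσ : 2 * σ ^ 2 < 1) (I : CoordPair d) :
    Integrable (fun y => blockDensity I σ y ^ 2) (nullBlock d m) := by
  have h := Integrable.fintype_prod_dep
    (μ := fun _ : Fin m => stdGaussian (EuclideanSpace ℝ (Fin d)))
    fun _ => integrable_pairDensity_sq hσ I
  refine h.congr (ae_of_all _ fun y => ?_)
  simp only [blockDensity, Finset.prod_pow]

theorem memLp_blockDensity {σ : ℝ} (hσ : 2 * σ ^ 2 < 1) (I : CoordPair d) :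
    MemLp (blockDensity I σ) 2 (nullBlock d m) :=
  (memLp_two_iff_integrable_sq (measurable_blockDensity I σ).aestronglyMeasurable).2
    (integrable_blockDensity_sq hσ I)

theorem memLp_blockCorr (I : CoordPair d) : MemLp (blockCorr I) 2 (nullBlock d m) := by
  refine memLp_finsetSum _ fun a _ => ?_
  exact (memLp_pairProd_and_moments I).1.comp_measurePreserving
    (measurePreserving_eval (fun _ : Fin m => stdGaussian (EuclideanSpace ℝ (Fin d))) a)

theorem integral_blockCorr_eq {μ : Measure (EuclideanSpace ℝ (Fin d))} [IsProbabilityMeasure μ]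
    {I : CoordPair d} (h : Integrable (pairProd I) μ) :
    ∫ y, blockCorr I y ∂(Measure.pi fun _ : Fin m => μ) = m * ∫ x, pairProd I x ∂μ := by
  unfold blockCorr
  rw [integral_finsetSum _ fun a _ => integrable_comp_eval (μ := fun _ : Fin m => μ) h]
  simp_rw [integral_comp_eval (μ := fun _ : Fin m => μ) h.aestronglyMeasurable]
  simp

theorem integral_blockCorr_sq (I : CoordPair d) :
    ∫ y, blockCorr I y ^ 2 ∂(nullBlock d m) = m := by
  obtain ⟨h1, h2, h3⟩ := memLp_pairProd_and_moments I
  rw [← variance_of_integral_eq_zero (measurable_blockCorr I).aemeasurable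
    (by rw [integral_blockCorr_eq (h1.integrable one_le_two), h2, mul_zero])]
  have e : blockCorr (m := m) I = ∑ a, fun y => pairProd I (y a) := by
    ext y; simp [blockCorr]
  rw [e, variance_sum_pi fun _ => h1]
  simp [variance_of_integral_eq_zero (measurable_pairProd I).aemeasurable h2, h3]

theorem integral_pairBlock_eq {σ : ℝ} (hσ : 2 * σ ^ 2 < 1) (I : CoordPair d)
    (f : (Fin m → EuclideanSpace ℝ (Fin d)) → ℝ) :
    ∫ y, f y ∂(pairBlock d m σ I) = ∫ y, blockDensity I σ y * f y ∂(nullBlock d m) := by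
  rw [pairBlock_eq_withDensity hσ, integral_withDensity_eq_integral_toReal_smul
    (measurable_blockDensity I σ).ennreal_ofReal (ae_of_all _ fun _ => ENNReal.ofReal_lt_top)]
  simp_rw [ENNReal.toReal_ofReal (blockDensity_nonneg I σ _), smul_eq_mul]

theorem integral_blockDensity {σ : ℝ} (hσ : 2 * σ ^ 2 < 1) (I : CoordPair d) :
    ∫ y, blockDensity I σ y ∂(nullBlock d m) = 1 := by
  have h := integral_pairBlock_eq (m := m) hσ I fun _ => 1
  simpa using h.symm

theorem integral_blockDensity_mul_blockCorr {σ : ℝ} (hσ : 2 * σ ^ 2 < 1) (I : CoordPair d) :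
    ∫ y, blockDensity I σ y * blockCorr I y ∂(nullBlock d m) = m * σ := by
  rw [← integral_pairBlock_eq hσ, integral_blockCorr_eq, integral_pairProd_pairGaussian hσ]
  rw [pairGaussian_eq_withDensity hσ, integrable_withDensity_iff_integrable_smul'
    (measurable_pairDensity I σ).ennreal_ofReal (ae_of_all _ fun _ => ENNReal.ofReal_lt_top)]
  simp_rw [ENNReal.toReal_ofReal (pairDensity_nonneg I σ _), smul_eq_mul]
  exact (memLp_pairDensity hσ I).integrable_mul (memLp_pairProd_and_moments I).1

theorem integral_blockDensity_sq_le {σ : ℝ} (hσ : m * σ ^ 2 ≤ 1 / 4) (hσ' : 2 * σ ^ 2 < 1)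
    (I : CoordPair d) :
    ∫ y, blockDensity I σ y ^ 2 ∂(nullBlock d m)
      ≤ 1 + m * σ ^ 2 + 4 * (m * σ ^ 2) ^ 2 := by
  have e : ∀ y : Fin m → EuclideanSpace ℝ (Fin d),
      blockDensity I σ y ^ 2 = ∏ a, pairDensity I σ (y a) ^ 2 := fun y => by
    rw [blockDensity, Finset.prod_pow]
  simp_rw [e]
  rw [integral_fintype_prod_eq_pow (fun x => pairDensity I σ x ^ 2), Fintype.card_fin]
  set a := m * σ ^ 2 with ha
  have ha0 : 0 ≤ a := by positivity
  have hp : 0 ≤ 1 - 2 * σ ^ 2 := by linarith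
  calc _ ≤ ((√(1 - 2 * σ ^ 2))⁻¹) ^ m := by
        exact pow_le_pow_left₀ (integral_nonneg fun x => sq_nonneg (pairDensity I σ x))
          (integral_pairDensity_sq_le hσ' I) m
    _ = (√((1 - 2 * σ ^ 2) ^ m))⁻¹ := by
        rw [inv_pow, ← Real.sqrt_sq (pow_nonneg (Real.sqrt_nonneg (1 - 2 * σ ^ 2)) m),
          ← pow_mul, mul_comm m 2, pow_mul, Real.sq_sqrt hp]
    _ ≤ (√(1 - 2 * a))⁻¹ := by
        have : 0 < 1 - 2 * a := by linarith
        gcongr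
        -- Bernoulli's inequality for `(1 - 2 σ²)^m`.
        have h := one_add_mul_le_pow (a := -(2 * σ ^ 2)) (by linarith) m
        calc 1 - 2 * a = 1 + m * -(2 * σ ^ 2) := by rw [ha]; ring
          _ ≤ _ := h
          _ = _ := by ring
    _ ≤ 1 + a + 4 * a ^ 2 := by
        have h1 : 0 < 1 - 2 * a := by linarith
        have h2 : 0 < 1 + a + 4 * a ^ 2 := by positivity
        rw [inv_le_comm₀ (Real.sqrt_pos.2 h1) h2]
        apply Real.le_sqrt_of_sq_le
        rw [inv_pow, inv_le_iff_one_le_mul₀ (by positivity)]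
        have h3 : (1 - 2 * a) * (1 + a + 4 * a ^ 2) ^ 2 - 1
            = a ^ 2 * (5 - 10 * a - 32 * a ^ 3) := by ring
        have h4 : 0 ≤ 5 - 10 * a - 32 * a ^ 3 := by nlinarith [mul_nonneg ha0 ha0]
        nlinarith [mul_nonneg (sq_nonneg a) h4]

/-- The part of `blockDensity` that is not affine in the empirical correlation. -/
noncomputable def blockRemainder (I : CoordPair d) (σ : ℝ)
    (y : Fin m → EuclideanSpace ℝ (Fin d)) : ℝ := blockDensity I σ y - 1 - σ * blockCorr I y

theorem memLp_blockRemainder {σ : ℝ} (hσ : 2 * σ ^ 2 < 1) (I : CoordPair d) :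
    MemLp (blockRemainder I σ) 2 (nullBlock d m) :=
  ((memLp_blockDensity hσ I).sub (memLp_const 1)).sub ((memLp_blockCorr I).const_mul σ)

/-- Expanding the square gives `∫ D² - 1 - m σ²` for the block density `D`, because `∫ D Z = m σ`
and `∫ Z² = m`. The first-order term of `integral_blockDensity_sq_le` cancels exactly. -/
theorem integral_blockRemainder_sq_le {σ : ℝ} (hσ : m * σ ^ 2 ≤ 1 / 4) (hσ' : 2 * σ ^ 2 < 1)
    (I : CoordPair d) :
    ∫ y, blockRemainder I σ y ^ 2 ∂(nullBlock d m) ≤ 4 * (m * σ ^ 2) ^ 2 := by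
  have hD := memLp_blockDensity (m := m) hσ' I
  have hZ := memLp_blockCorr (m := m) I
  have hDZ : Integrable (fun y => blockDensity I σ y * blockCorr I y) (nullBlock d m) :=
    hD.integrable_mul hZ
  have hD1 := hD.integrable one_le_two
  have hZ1 := hZ.integrable one_le_two
  have e : ∀ y : Fin m → EuclideanSpace ℝ (Fin d), blockRemainder I σ y ^ 2
      = (blockDensity I σ y ^ 2 - 2 * blockDensity I σ y + 1)
        + (σ ^ 2 * blockCorr I y ^ 2 - 2 * σ * (blockDensity I σ y * blockCorr I y)
          + 2 * σ * blockCorr I y) := fun y => by rw [blockRemainder]; ring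
  simp_rw [e]
  obtain ⟨h1, h2, h3⟩ := memLp_pairProd_and_moments I
  rw [integral_add, integral_add, integral_sub, integral_add, integral_sub, integral_const_mul,
    integral_const_mul, integral_const_mul, integral_const_mul, integral_blockCorr_sq,
    integral_blockDensity hσ', integral_blockDensity_mul_blockCorr hσ',
    integral_blockCorr_eq (h1.integrable one_le_two), h2, integral_const]
  · have := integral_blockDensity_sq_le hσ hσ' I
    simp only [probReal_univ, smul_eq_mul]
    nlinarith
  · exact hZ.integrable_sq.const_mul _
  · exact hDZ.const_mul _
  · exact (hZ.integrable_sq.const_mul _).sub (hDZ.const_mul _)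
  · exact hZ1.const_mul _
  · exact hD.integrable_sq
  · exact hD1.const_mul _
  · exact hD.integrable_sq.sub (hD1.const_mul _)
  · exact integrable_const _
  · exact (hD.integrable_sq.sub (hD1.const_mul _)).add (integrable_const _)
  · exact ((hZ.integrable_sq.const_mul _).sub (hDZ.const_mul _)).add (hZ1.const_mul _)

theorem integral_blockDensity_sub_one_sq_le {σ : ℝ} (hσ : m * σ ^ 2 ≤ 1 / 4)
    (hσ' : 2 * σ ^ 2 < 1) (I : CoordPair d) :
    ∫ y, (blockDensity I σ y - 1) ^ 2 ∂(nullBlock d m) ≤ 2 * (m * σ ^ 2) := by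
  have hD := memLp_blockDensity (m := m) hσ' I
  have hD1 := hD.integrable one_le_two
  have e : ∀ y : Fin m → EuclideanSpace ℝ (Fin d), (blockDensity I σ y - 1) ^ 2
      = blockDensity I σ y ^ 2 - 2 * blockDensity I σ y + 1 := fun y => by ring
  simp_rw [e]
  rw [integral_add, integral_sub, integral_const_mul, integral_blockDensity hσ', integral_const]
  · have := integral_blockDensity_sq_le hσ hσ' I
    have h0 : 0 ≤ m * σ ^ 2 := by positivity
    simp only [probReal_univ, smul_eq_mul]
    nlinarith
  · exact hD.integrable_sq
  · exact hD1.const_mul _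
  · exact hD.integrable_sq.sub (hD1.const_mul _)
  · exact integrable_const _

theorem relChange_block_eq {σ : ℝ} (hσ : 2 * σ ^ 2 < 1) (I : CoordPair d)
    {s : Set (Fin m → EuclideanSpace ℝ (Fin d))} (hs : MeasurableSet s)
    (hp : (nullBlock d m).real s ≠ 0) :
    relChange (nullBlock d m) (pairBlock d m σ I) s
      = (∫ y in s, (blockDensity I σ y - 1) ∂(nullBlock d m)) / (nullBlock d m).real s := by
  have hD1 := (memLp_blockDensity (m := m) hσ I).integrable one_le_two
  have hq : (pairBlock d m σ I).real s = ∫ y in s, blockDensity I σ y ∂(nullBlock d m) := by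
    rw [pairBlock_eq_withDensity hσ, Measure.real, withDensity_apply _ hs,
      ← ofReal_integral_eq_lintegral_ofReal hD1.integrableOn
      (ae_of_all _ fun _ => blockDensity_nonneg I σ _), ENNReal.toReal_ofReal]
    exact integral_nonneg fun _ => blockDensity_nonneg I σ _
  rw [relChange, hq, integral_sub hD1.integrableOn (integrable_const _), setIntegral_const,
    smul_eq_mul, mul_one, sub_div, div_self hp]

theorem integrable_exp_sum_blockCorr {W : CoordPair d → ℝ} (hW : ∑ I, W I ^ 2 ≤ 1 / 8) :
    Integrable (fun y => Real.exp (∑ I, W I * blockCorr I y)) (nullBlock d m) ∧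
    ∫ y, Real.exp (∑ I, W I * blockCorr I y) ∂(nullBlock d m)
      ≤ Real.exp (2 * m * ∑ I, W I ^ 2) := by
  have e : ∀ y : Fin m → EuclideanSpace ℝ (Fin d), Real.exp (∑ I, W I * blockCorr I y)
      = ∏ a, Real.exp (∑ I, W I * pairProd I (y a)) := fun y => by
    rw [← Real.exp_sum]
    congr 1
    simp_rw [blockCorr, Finset.mul_sum]
    exact Finset.sum_comm
  simp_rw [e]
  have hi : ∀ _ : Fin m, Integrable (fun x => Real.exp (∑ I, W I * pairProd I x))
    (stdGaussian (EuclideanSpace ℝ (Fin d))) := fun _ => integrable_exp_sum_pairProd hW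
  have hi' := Integrable.fintype_prod_dep
    (μ := fun _ : Fin m => stdGaussian (EuclideanSpace ℝ (Fin d))) hi
  refine ⟨hi', ?_⟩
  rw [integral_fintype_prod_eq_pow (fun x => Real.exp (∑ I, W I * pairProd I x)),
    Fintype.card_fin]
  calc _ ≤ Real.exp (2 * ∑ I, W I ^ 2) ^ m :=
        pow_le_pow_left₀ (integral_nonneg fun _ => (Real.exp_pos _).le)
          (integral_exp_sum_pairProd_le hW) m
    _ = _ := by rw [← Real.exp_nat_mul]; congr 1; ring

/-- The vector of average empirical correlations over an event of probability `p` has norm at most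
of order `√(m * log p⁻¹)`. -/
theorem sqrt_sum_setAverage_blockCorr_sq_le {s : Set (Fin m → EuclideanSpace ℝ (Fin d))}
    (hp : 0 < (nullBlock d m).real s) {l : ℝ} (hl : 0 < l) (hl8 : l ^ 2 ≤ 1 / 8) :
    √(∑ I : CoordPair d,
        ((∫ y in s, blockCorr I y ∂(nullBlock d m)) / (nullBlock d m).real s) ^ 2)
      ≤ 2 * l * m + Real.log ((nullBlock d m).real s)⁻¹ / l := by
  set p := (nullBlock d m).real s with hp_def
  set z : CoordPair d → ℝ := fun I => (∫ y in s, blockCorr I y ∂(nullBlock d m)) / p with hz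
  set n := √(∑ I, z I ^ 2) with hn
  have hp1 : p ≤ 1 := measureReal_le_one
  have hL : 0 ≤ Real.log p⁻¹ := Real.log_nonneg ((one_le_inv₀ hp).2 hp1)
  rcases (Real.sqrt_nonneg (∑ I, z I ^ 2)).eq_or_lt with h0 | hpos
  · rw [hn, ← h0]; positivity
  rw [← hn] at hpos
  have hn2 : ∑ I, z I ^ 2 = n ^ 2 :=
    (Real.sq_sqrt (Finset.sum_nonneg fun I _ => sq_nonneg (z I))).symm
  -- The vector of norm `l` in the direction of `z`. It makes the exponent in Jensen's inequality
  -- equal to `l * n`.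
  set W : CoordPair d → ℝ := fun I => l / n * z I with hW
  have hW2 : ∑ I, W I ^ 2 = l ^ 2 := by
    simp_rw [hW, mul_pow, ← Finset.mul_sum, hn2]
    field_simp
  obtain ⟨hi, hle⟩ := integrable_exp_sum_blockCorr (m := m) (W := W) (by rw [hW2]; exact hl8)
  have hint : ∀ I : CoordPair d, Integrable (fun y => W I * blockCorr I y) (nullBlock d m) :=
    fun I => ((memLp_blockCorr I).integrable one_le_two).const_mul _
  have hJ := mul_exp_setAverage_le hp
    (integrable_finsetSum _ fun I _ => hint I).integrableOn hi
  rw [integral_finsetSum _ fun I _ => (hint I).integrableOn, Finset.sum_div] at hJ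
  have hsum : ∑ I, (∫ y in s, W I * blockCorr I y ∂(nullBlock d m)) / p = l * n := by
    have : ∀ I, (∫ y in s, W I * blockCorr I y ∂(nullBlock d m)) / p = l / n * z I ^ 2 := by
      intro I
      rw [integral_const_mul, mul_div_assoc, hW]
      simp only [hz]
      ring
    simp_rw [this, ← Finset.mul_sum, hn2]
    field_simp
  rw [← hp_def, hsum] at hJ
  rw [hW2] at hle
  have h := Real.log_le_log (by positivity) (hJ.trans hle)
  rw [Real.log_mul hp.ne' (Real.exp_pos _).ne', Real.log_exp, Real.log_exp] at h
  rw [Real.log_inv]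
  have : l * n ≤ l * (2 * l * m + -Real.log p / l) := by
    rw [mul_add, mul_div_cancel₀ _ hl.ne']
    linarith
  exact le_of_mul_le_mul_left this hl

end Block

/-! ### Mean square relative changes for a rectangular partition into block cells. -/

section BlockPartition

variable {d m : ℕ} {κ Γ : Type*} [Fintype κ]
  {A : κ → Γ → Set (Fin m → EuclideanSpace ℝ (Fin d))}

/-- On a null cell the default values of the two quotients differ, but the weight vanishes. -/
theorem prod_mul_relChange_block_sq_eq {σ : ℝ} (hσ : 2 * σ ^ 2 < 1) (I : CoordPair d)
    (hA : ∀ j π, MeasurableSet (A j π)) (j : κ) (π : Γ) :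
    (∏ i, (nullBlock d m).real (A i π))
        * relChange (nullBlock d m) (pairBlock d m σ I) (A j π) ^ 2
      = (∏ i, (nullBlock d m).real (A i π))
        * ((∫ y in A j π, (blockDensity I σ y - 1) ∂(nullBlock d m))
          / (nullBlock d m).real (A j π)) ^ 2 := by
  by_cases hp : (nullBlock d m).real (A j π) = 0
  · rw [Finset.prod_eq_zero (Finset.mem_univ j) hp, zero_mul, zero_mul]
  · rw [relChange_block_eq hσ I (hA j π) hp]

variable [DecidableEq κ] [Fintype Γ]

/-- A bound for a single pair by the full information in a block, whatever the memory. It serves the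
regime `d² ≤ s ℓ`. -/
theorem sum_prod_mul_relChange_block_sq_le {σ : ℝ} (hσ : m * σ ^ 2 ≤ 1 / 4)
    (hσ' : 2 * σ ^ 2 < 1) (I : CoordPair d) (hA : ∀ j π, MeasurableSet (A j π))
    (hpart : ∀ x : κ → Fin m → EuclideanSpace ℝ (Fin d), ∃! π, ∀ j, x j ∈ A j π) (j : κ) :
    ∑ π, (∏ i, (nullBlock d m).real (A i π))
        * relChange (nullBlock d m) (pairBlock d m σ I) (A j π) ^ 2 ≤ 2 * (m * σ ^ 2) := by
  simp_rw [prod_mul_relChange_block_sq_eq hσ' I hA]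
  exact (sum_prod_mul_setAverage_sq_le hA hpart j
    ((memLp_blockDensity hσ' I).sub (memLp_const 1))).trans
    (integral_blockDensity_sub_one_sq_le hσ hσ' I)

theorem sum_prod_mul_sum_blockCorr_sq_le (hA : ∀ j π, MeasurableSet (A j π))
    (hpart : ∀ x : κ → Fin m → EuclideanSpace ℝ (Fin d), ∃! π, ∀ j, x j ∈ A j π) (j : κ)
    {B : ℕ} (hB1 : 1 ≤ B)
    (hB : ∀ (x : κ → Fin m → EuclideanSpace ℝ (Fin d)) (s : Finset Γ),
      (∀ π ∈ s, ∀ i, i ≠ j → x i ∈ A i π) → s.card ≤ B)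
    {l : ℝ} (hl : 0 < l) (hl8 : l ^ 2 ≤ 1 / 8) :
    ∑ π, (∏ i, (nullBlock d m).real (A i π)) * ∑ I : CoordPair d,
        ((∫ y in A j π, blockCorr I y ∂(nullBlock d m)) / (nullBlock d m).real (A j π)) ^ 2
      ≤ 8 * l ^ 2 * m ^ 2 + 2 / l ^ 2 * (2 * Real.log B ^ 2 + 4) := by
  have h1 := sum_prod_measureReal hA hpart fun _ => nullBlock d m
  simp only [probReal_univ, Finset.prod_const_one] at h1
  have hL := sum_prod_mul_log_inv_sq_le hA (nullBlock d m) hpart j hB1 hB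
  calc _ ≤ ∑ π, (∏ i, (nullBlock d m).real (A i π)) * (8 * l ^ 2 * m ^ 2
          + 2 / l ^ 2 * Real.log ((nullBlock d m).real (A j π))⁻¹ ^ 2) := by
        refine Finset.sum_le_sum fun π _ => ?_
        rcases (measureReal_nonneg (μ := nullBlock d m) (s := A j π)).eq_or_lt with hp | hp
        · rw [Finset.prod_eq_zero (Finset.mem_univ j) hp.symm, zero_mul, zero_mul]
        refine mul_le_mul_of_nonneg_left ?_ (Finset.prod_nonneg fun i _ => measureReal_nonneg)
        have h := sqrt_sum_setAverage_blockCorr_sq_le hp hl hl8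
        rw [Real.sqrt_le_left (by
          have := Real.log_nonneg ((one_le_inv₀ hp).2 measureReal_le_one)
          positivity)] at h
        refine h.trans ?_
        have e : 2 / l ^ 2 * Real.log ((nullBlock d m).real (A j π))⁻¹ ^ 2
            = 2 * (Real.log ((nullBlock d m).real (A j π))⁻¹ / l) ^ 2 := by ring
        rw [e]
        nlinarith [sq_nonneg (2 * l * m - Real.log ((nullBlock d m).real (A j π))⁻¹ / l)]
    _ = 8 * l ^ 2 * m ^ 2 * ∑ π, (∏ i, (nullBlock d m).real (A i π))
          + 2 / l ^ 2 * ∑ π, (∏ i, (nullBlock d m).real (A i π))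
            * Real.log ((nullBlock d m).real (A j π))⁻¹ ^ 2 := by
        rw [Finset.mul_sum, Finset.mul_sum, ← Finset.sum_add_distrib]
        exact Finset.sum_congr rfl fun π _ => by ring
    _ ≤ _ := by
        rw [h1, mul_one]
        gcongr

/-- Splitting the density into `σ Z_I` and the remainder, the first part is controlled for all `I`
jointly through the memory size, the second for each `I` separately by Bessel's inequality. -/
theorem sum_sum_prod_mul_relChange_block_sq_le {σ : ℝ} (hσ : m * σ ^ 2 ≤ 1 / 4)
    (hσ' : 2 * σ ^ 2 < 1) (hA : ∀ j π, MeasurableSet (A j π))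
    (hpart : ∀ x : κ → Fin m → EuclideanSpace ℝ (Fin d), ∃! π, ∀ j, x j ∈ A j π) (j : κ)
    {B : ℕ} (hB1 : 1 ≤ B)
    (hB : ∀ (x : κ → Fin m → EuclideanSpace ℝ (Fin d)) (s : Finset Γ),
      (∀ π ∈ s, ∀ i, i ≠ j → x i ∈ A i π) → s.card ≤ B)
    {l : ℝ} (hl : 0 < l) (hl8 : l ^ 2 ≤ 1 / 8) :
    ∑ I : CoordPair d, ∑ π, (∏ i, (nullBlock d m).real (A i π))
        * relChange (nullBlock d m) (pairBlock d m σ I) (A j π) ^ 2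
      ≤ 2 * σ ^ 2 * (8 * l ^ 2 * m ^ 2 + 2 / l ^ 2 * (2 * Real.log B ^ 2 + 4))
        + Fintype.card (CoordPair d) * (8 * (m * σ ^ 2) ^ 2) := by
  have hw : ∀ π, 0 ≤ ∏ i, (nullBlock d m).real (A i π) := fun π =>
    Finset.prod_nonneg fun i _ => measureReal_nonneg
  have hpt : ∀ (I : CoordPair d) π, (∏ i, (nullBlock d m).real (A i π))
        * relChange (nullBlock d m) (pairBlock d m σ I) (A j π) ^ 2
      ≤ 2 * σ ^ 2 * ((∏ i, (nullBlock d m).real (A i π))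
          * ((∫ y in A j π, blockCorr I y ∂(nullBlock d m)) / (nullBlock d m).real (A j π)) ^ 2)
        + 2 * ((∏ i, (nullBlock d m).real (A i π))
          * ((∫ y in A j π, blockRemainder I σ y ∂(nullBlock d m))
            / (nullBlock d m).real (A j π)) ^ 2) := by
    intro I π
    rw [prod_mul_relChange_block_sq_eq hσ' I hA]
    have hZ := ((memLp_blockCorr (m := m) I).integrable one_le_two).const_mul σ
    have hR := (memLp_blockRemainder (m := m) hσ' I).integrable one_le_two
    have e : ∫ y in A j π, (blockDensity I σ y - 1) ∂(nullBlock d m)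
        = σ * ∫ y in A j π, blockCorr I y ∂(nullBlock d m)
          + ∫ y in A j π, blockRemainder I σ y ∂(nullBlock d m) := by
      rw [← integral_const_mul, ← integral_add hZ.integrableOn hR.integrableOn]
      refine integral_congr_ae (ae_of_all _ fun y => ?_)
      simp only [blockRemainder]
      ring
    rw [e, add_div, mul_div_assoc]
    set z := (∫ y in A j π, blockCorr I y ∂(nullBlock d m)) / (nullBlock d m).real (A j π)
    set r := (∫ y in A j π, blockRemainder I σ y ∂(nullBlock d m))
      / (nullBlock d m).real (A j π)
    have : (σ * z + r) ^ 2 ≤ 2 * σ ^ 2 * z ^ 2 + 2 * r ^ 2 := by nlinarith [sq_nonneg (σ * z - r)]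
    calc _ ≤ (∏ i, (nullBlock d m).real (A i π)) * (2 * σ ^ 2 * z ^ 2 + 2 * r ^ 2) :=
          mul_le_mul_of_nonneg_left this (hw π)
      _ = _ := by ring
  have hR : ∀ I : CoordPair d, ∑ π, (∏ i, (nullBlock d m).real (A i π))
      * ((∫ y in A j π, blockRemainder I σ y ∂(nullBlock d m))
        / (nullBlock d m).real (A j π)) ^ 2 ≤ 4 * (m * σ ^ 2) ^ 2 := fun I =>
    (sum_prod_mul_setAverage_sq_le hA hpart j (memLp_blockRemainder hσ' I)).trans
      (integral_blockRemainder_sq_le hσ hσ' I)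
  have hZ := sum_prod_mul_sum_blockCorr_sq_le hA hpart j hB1 hB hl hl8
  calc _ ≤ ∑ I : CoordPair d, ∑ π, _ :=
        Finset.sum_le_sum fun I _ => Finset.sum_le_sum fun π _ => hpt I π
    _ = 2 * σ ^ 2 * (∑ π, (∏ i, (nullBlock d m).real (A i π)) * ∑ I : CoordPair d,
          ((∫ y in A j π, blockCorr I y ∂(nullBlock d m)) / (nullBlock d m).real (A j π)) ^ 2)
        + 2 * ∑ I : CoordPair d, ∑ π, (∏ i, (nullBlock d m).real (A i π))
          * ((∫ y in A j π, blockRemainder I σ y ∂(nullBlock d m))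
            / (nullBlock d m).real (A j π)) ^ 2 := by
        simp_rw [Finset.sum_add_distrib, ← Finset.mul_sum]
        congr 2
        rw [Finset.sum_comm]
        simp_rw [Finset.mul_sum]
    _ ≤ _ := by
        refine add_le_add (mul_le_mul_of_nonneg_left hZ (by positivity)) ?_
        calc _ ≤ 2 * ∑ I : CoordPair d, 4 * (m * σ ^ 2) ^ 2 := by
              gcongr with I _
              exact hR I
          _ = _ := by
              rw [Finset.sum_const, nsmul_eq_mul, Finset.card_univ]; ring

end BlockPartition

/-! ### Transcripts and their cells. -/

namespace MemoryAlgorithm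

section Transcript

variable {X O : Type*} [MeasurableSpace X] {k s ℓ : ℕ}

/-- The memory content before time step `n`, if `π` lists the contents after the time steps. -/
def memoryBefore (A : MemoryAlgorithm X O k s ℓ) (π : Fin (ℓ * k) → Fin s → Bool)
    (n : ℕ) (hn : n ≤ ℓ * k) : Fin s → Bool :=
  match n, hn with
  | 0, _ => A.init
  | n + 1, h => π ⟨n, h⟩

/-- The values of data point `j` that are consistent with the transcript `π`. -/
def cell (A : MemoryAlgorithm X O k s ℓ) (j : Fin k) (π : Fin (ℓ * k) → Fin s → Bool) : Set X :=
  {y | ∀ n : Fin (ℓ * k), n.modNat = j → A.step n y (A.memoryBefore π n n.2.le) = π n}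

variable (A : MemoryAlgorithm X O k s ℓ)

theorem measurableSet_cell (j : Fin k) (π : Fin (ℓ * k) → Fin s → Bool) :
    MeasurableSet (A.cell j π) := by
  have : A.cell j π = ⋂ n : Fin (ℓ * k), ⋂ _ : n.modNat = j,
      (fun y => A.step n y (A.memoryBefore π n n.2.le)) ⁻¹' {π n} := by
    ext y; simp [cell]
  rw [this]
  exact MeasurableSet.iInter fun n => MeasurableSet.iInter fun _ =>
    A.measurable_step n _ (MeasurableSet.singleton _)

theorem memoryBefore_eq_memory {x : Fin k → X} {π : Fin (ℓ * k) → Fin s → Bool}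
    (h : ∀ j, x j ∈ A.cell j π) (n : ℕ) (hn : n ≤ ℓ * k) :
    A.memoryBefore π n hn = A.memory x n hn := by
  induction n with
  | zero => rfl
  | succ n ih =>
    have h1 := h _ ⟨n, hn⟩ rfl
    rw [memory, ← ih (Nat.le_of_succ_le hn)]
    exact h1.symm

theorem existsUnique_transcript (x : Fin k → X) : ∃! π, ∀ j, x j ∈ A.cell j π := by
  refine ⟨fun n => A.memory x (n + 1) n.2, ?_, ?_⟩
  · rintro j n rfl
    obtain ⟨n, hn⟩ := n
    have : A.memoryBefore (fun n => A.memory x (n + 1) n.2) n hn.le = A.memory x n hn.le := by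
      cases n <;> rfl
    simp only [this]
    rfl
  · intro π hπ
    ext1 n
    exact A.memoryBefore_eq_memory hπ (n + 1) n.2

/-- Once the other data points are fixed, a transcript is determined by the states after the `ℓ`
visits to point `j`; all other steps can be recomputed. -/
theorem card_transcripts_le (j : Fin k) (x : Fin k → X)
    (S : Finset (Fin (ℓ * k) → Fin s → Bool))
    (hS : ∀ π ∈ S, ∀ i, i ≠ j → x i ∈ A.cell i π) : S.card ≤ 2 ^ (s * ℓ) := by
  have hinj : Set.InjOn (fun (π : Fin (ℓ * k) → Fin s → Bool) (r : Fin ℓ) =>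
      π (finProdFinEquiv (r, j))) S := by
    intro π hπ π' hπ' heq
    have key : ∀ n (hn : n ≤ ℓ * k), A.memoryBefore π n hn = A.memoryBefore π' n hn := by
      intro n
      induction n with
      | zero => exact fun _ => rfl
      | succ n ih =>
        intro hn
        change π ⟨n, hn⟩ = π' ⟨n, hn⟩
        by_cases hj : (⟨n, hn⟩ : Fin (ℓ * k)).modNat = j
        · have h1 : (⟨n, hn⟩ : Fin (ℓ * k))
              = finProdFinEquiv ((⟨n, hn⟩ : Fin (ℓ * k)).divNat, j) := by
            rw [← hj]
            exact (finProdFinEquiv.apply_symm_apply (⟨n, hn⟩ : Fin (ℓ * k))).symm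
          rw [h1]
          exact congrFun heq _
        · rw [← hS π hπ _ hj ⟨n, hn⟩ rfl, ← hS π' hπ' _ hj ⟨n, hn⟩ rfl]
          congr 1
          exact ih _
    ext1 n
    exact key (n + 1) n.2
  have h := Finset.card_le_card_of_injOn (t := Finset.univ) _ (fun _ _ => Finset.mem_univ _) hinj
  refine h.trans ?_
  rw [Finset.card_univ]
  simp [pow_mul]

/-- The output of the algorithm, as a function of the transcript. -/
def transcriptOutput (π : Fin (ℓ * k) → Fin s → Bool) : O :=
  A.output (A.memoryBefore π (ℓ * k) le_rfl)

theorem setOf_result_eq [DecidableEq O] (o : O) :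
    {x | A.result x = o} = ⋃ π ∈ Finset.univ.filter (A.transcriptOutput · = o),
      Set.univ.pi fun j => A.cell j π := by
  ext x
  simp only [Set.mem_ofPred_eq, Set.mem_iUnion, Finset.mem_filter, Finset.mem_univ, true_and,
    exists_prop, Set.mem_pi]
  have hres : ∀ π, (∀ j, x j ∈ A.cell j π) → A.transcriptOutput π = A.result x := fun π hπ => by
    rw [transcriptOutput, A.memoryBefore_eq_memory hπ, result]
  constructor
  · intro hx
    obtain ⟨π, hπ, -⟩ := A.existsUnique_transcript x
    exact ⟨π, (hres π hπ).trans hx, fun j _ => hπ j⟩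
  · rintro ⟨π, ho, hπ⟩
    rw [← hres π fun j => hπ j trivial, ho]

theorem measurableSet_result_eq (o : O) : MeasurableSet {x | A.result x = o} := by
  classical
  rw [setOf_result_eq]
  exact Finset.measurableSet_biUnion _ fun π _ =>
    MeasurableSet.univ_pi fun j => A.measurableSet_cell j π

theorem measureReal_result_eq [DecidableEq O] (μ : Measure X) [IsProbabilityMeasure μ] (o : O) :
    (Measure.pi fun _ : Fin k => μ).real {x | A.result x = o}
      = ∑ π with A.transcriptOutput π = o, ∏ j, μ.real (A.cell j π) := by
  rw [setOf_result_eq, measureReal_biUnion_finset]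
  · simp_rw [measureReal_pi_pi]
  · intro π _ π' _ hne
    refine Set.disjoint_left.2 fun x hx hx' => hne ?_
    exact (A.existsUnique_transcript x).unique (fun j => hx j (Set.mem_univ j))
      (fun j => hx' j (Set.mem_univ j))
  · exact fun π _ => MeasurableSet.univ_pi fun j => A.measurableSet_cell j π

/-- An algorithm that identifies a member of a family makes the transcript depend on the member. -/
theorem card_le_sum_relChange_sq {ι : Type*} [Fintype ι] [DecidableEq ι]
    (A : MemoryAlgorithm X ι k s ℓ) (P : Measure X) [IsProbabilityMeasure P] (Q : ι → Measure X)
    [∀ i, IsProbabilityMeasure (Q i)] (hQ : ∀ i, Q i ≪ P) (hcard : 10 ≤ Fintype.card ι)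
    (hA : A.IdentifiesWithError Q (1 / 6)) :
    (Fintype.card ι : ℝ) ≤ 20 * ∑ j, ∑ i, ∑ π, (∏ a, P.real (A.cell a π))
      * relChange P (Q i) (A.cell j π) ^ 2 := by
  have hN : (10 : ℝ) ≤ Fintype.card ι := by exact_mod_cast hcard
  have hsplit : ∀ (i : ι) (μ : Measure X) [IsProbabilityMeasure μ],
      ∑ π with ¬ A.transcriptOutput π = i, ∏ j, μ.real (A.cell j π)
        = 1 - ∑ π with A.transcriptOutput π = i, ∏ j, μ.real (A.cell j π) := by
    intro i μ _
    have h := sum_prod_measureReal A.measurableSet_cell A.existsUnique_transcript fun _ => μ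
    simp only [probReal_univ, Finset.prod_const_one] at h
    rw [← h, ← Finset.sum_filter_add_sum_filter_not Finset.univ (A.transcriptOutput · = i)]
    ring
  have hi : ∀ i, 1 - ∑ π with A.transcriptOutput π = i, ∏ j, P.real (A.cell j π)
      - 8 * ∑ j, ∑ π, (∏ a, P.real (A.cell a π)) * relChange P (Q i) (A.cell j π) ^ 2
      ≤ Real.exp 1 / 6 := by
    intro i
    have h1 := exp_neg_one_mul_sub_le_sum_prod A.measurableSet_cell A.existsUnique_transcript
      (hQ i) (Finset.univ.filter fun π => ¬ A.transcriptOutput π = i)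
    have h2 := hA i
    rw [measureReal_result_eq] at h2
    rw [hsplit i P, hsplit i (Q i)] at h1
    rw [Real.exp_neg, inv_mul_le_iff₀ (Real.exp_pos 1)] at h1
    refine h1.trans ?_
    rw [div_eq_mul_inv]
    gcongr
    linarith
  have hsum := Finset.sum_le_sum fun i (_ : i ∈ Finset.univ) => hi i
  have htot : ∑ i, ∑ π with A.transcriptOutput π = i, ∏ j, P.real (A.cell j π) = 1 := by
    have h := sum_prod_measureReal A.measurableSet_cell A.existsUnique_transcript fun _ => P
    simp only [probReal_univ, Finset.prod_const_one] at h
    rw [← h]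
    exact Finset.sum_fiberwise _ _ _
  rw [Finset.sum_sub_distrib, Finset.sum_sub_distrib, htot, ← Finset.mul_sum,
    Finset.sum_comm] at hsum
  simp only [Finset.sum_const, Finset.card_univ, nsmul_eq_mul, mul_one] at hsum
  -- Numerically `1 - e/6 - 1/10 > 8/20`, where `1/10` absorbs the total null probability `1` since
  -- `N ≥ 10`.
  have he := Real.exp_one_lt_d9
  nlinarith

end Transcript

end MemoryAlgorithm

/-! ### Regarding an algorithm on points as one on blocks, with padding in the last block. -/

/-- The first `t` of the `k * m` points that are arranged in `k` blocks of size `m`. -/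
def flattenBlocks {X : Type*} {k m t : ℕ} (h : t ≤ k * m) (y : Fin k → Fin m → X) (a : Fin t) : X :=
  y (Fin.divNat (⟨a, a.2.trans_le h⟩ : Fin (k * m)))
    (Fin.modNat (⟨a, a.2.trans_le h⟩ : Fin (k * m)))

theorem flattenBlocks_eq {X : Type*} {k m t : ℕ} (h : t ≤ k * m) (y : Fin k → Fin m → X) {i b : ℕ} (hi : i < k)
    (hb : b < m) (hib : i * m + b < t) :
    flattenBlocks h y ⟨i * m + b, hib⟩ = y ⟨i, hi⟩ ⟨b, hb⟩ := by
  have h1 : (i * m + b) / m = i := by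
    rw [mul_comm, Nat.mul_add_div (by omega), Nat.div_eq_of_lt hb, add_zero]
  have h2 : (i * m + b) % m = b := by
    rw [mul_comm, Nat.mul_add_mod, Nat.mod_eq_of_lt hb]
  unfold flattenBlocks
  exact congrArg₂ y (Fin.ext h1) (Fin.ext h2)

section Flatten

variable {X : Type*} [MeasurableSpace X] {k m t : ℕ}

theorem measurable_flattenBlocks (h : t ≤ k * m) :
    Measurable (flattenBlocks (X := X) h) := by
  unfold flattenBlocks
  fun_prop

theorem map_flattenBlocks_pi (h : t ≤ k * m) (μ : Measure X) [IsProbabilityMeasure μ] :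
    (Measure.pi fun _ : Fin k => Measure.pi fun _ : Fin m => μ).map (flattenBlocks h)
      = Measure.pi fun _ : Fin t => μ := by
  refine (Measure.pi_eq fun s hs => ?_).symm
  rw [Measure.map_apply (measurable_flattenBlocks h) (MeasurableSet.univ_pi hs)]
  -- The padding points beyond `t` are unconstrained and contribute factors `1`.
  let S : ℕ → Set X := fun n => if hn : n < t then s ⟨n, hn⟩ else Set.univ
  have hpre : flattenBlocks h ⁻¹' Set.univ.pi s
      = Set.univ.pi fun i : Fin k => Set.univ.pi fun b : Fin m => S (finProdFinEquiv (i, b)) := by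
    ext y
    simp only [Set.mem_preimage, Set.mem_pi, Set.mem_univ, forall_true_left]
    constructor
    · intro hy i b
      by_cases hn : (finProdFinEquiv (i, b) : ℕ) < t
      · have h1 := hy ⟨_, hn⟩
        have h2 : flattenBlocks h y ⟨_, hn⟩ = y i b := by
          have := finProdFinEquiv.symm_apply_apply (i, b)
          exact congrArg (fun p : Fin k × Fin m => y p.1 p.2) this
        rw [h2] at h1
        simp only [S]
        rwa [dif_pos hn]
      · simp only [S]
        rw [dif_neg hn]
        trivial
    · intro hy a
      have h1 := hy (Fin.divNat (⟨a, a.2.trans_le h⟩ : Fin (k * m)))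
        (Fin.modNat (⟨a, a.2.trans_le h⟩ : Fin (k * m)))
      have h2 : finProdFinEquiv (Fin.divNat (⟨a, a.2.trans_le h⟩ : Fin (k * m)),
          Fin.modNat (⟨a, a.2.trans_le h⟩ : Fin (k * m))) = ⟨a, a.2.trans_le h⟩ :=
        finProdFinEquiv.apply_symm_apply (⟨a, a.2.trans_le h⟩ : Fin (k * m))
      rw [h2] at h1
      simpa [S, flattenBlocks] using h1
  rw [hpre, Measure.pi_pi]
  simp_rw [Measure.pi_pi]
  rw [← Fintype.prod_prod_type' (f := fun i b => μ (S (finProdFinEquiv (i, b)))),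
    finProdFinEquiv.prod_comp (fun n => μ (S n)),
    Fin.prod_univ_eq_prod_range (fun n => μ (S n)) (k * m)]
  have h3 : ∏ i, μ (s i) = ∏ i : Fin t, μ (S i) :=
    Finset.prod_congr rfl fun i _ => by simp [S]
  rw [h3, Fin.prod_univ_eq_prod_range (fun n => μ (S n)) t]
  refine (Finset.prod_subset (Finset.range_subset_range.2 h) fun n _ hn => ?_).symm
  have : ¬ n < t := by simpa using hn
  simp [S, this]

end Flatten

namespace MemoryAlgorithm

variable {X O : Type*} [MeasurableSpace X] {t s ℓ : ℕ} (A : MemoryAlgorithm X O t s ℓ)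

/-- The update at time step `n` of the algorithm, doing nothing after the last time step. -/
def stepNat (n : ℕ) (x : X) (u : Fin s → Bool) : Fin s → Bool :=
  if h : n < ℓ * t then A.step ⟨n, h⟩ x u else u

/-- The effect on the memory of the first `b` points of block `i` in pass `r`. -/
def blockRun (A : MemoryAlgorithm X O t s ℓ) {m : ℕ} (r i : ℕ) (y : Fin m → X) (u : Fin s → Bool) : ℕ → Fin s → Bool
  | 0 => u
  | b + 1 => if h : b < m ∧ i * m + b < t then
      A.stepNat (r * t + (i * m + b)) (y ⟨b, h.1⟩) (A.blockRun r i y u b)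
    else A.blockRun r i y u b

theorem measurable_stepNat (n : ℕ) (u : Fin s → Bool) : Measurable fun x => A.stepNat n x u := by
  unfold stepNat
  split_ifs
  exacts [A.measurable_step _ _, measurable_const]

theorem measurable_blockRun {m : ℕ} (r i : ℕ) (u : Fin s → Bool) (b : ℕ) :
    Measurable fun y : Fin m → X => A.blockRun r i y u b := by
  induction b with
  | zero => exact measurable_const
  | succ b ih =>
    simp only [blockRun]
    split_ifs with h
    · have h1 : Measurable fun p : X × (Fin s → Bool) =>
          A.stepNat (r * t + (i * m + b)) p.1 p.2 :=
        measurable_from_prod_countable_left fun v => A.measurable_stepNat _ v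
      exact h1.comp ((measurable_pi_apply _).prodMk ih)
    · exact ih

/-- The algorithm, regarded as one that processes blocks of `m` points. -/
def blocked (m k : ℕ) : MemoryAlgorithm (Fin m → X) O k s ℓ where
  init := A.init
  step n y u := A.blockRun (n / k) (n % k) y u m
  measurable_step _ _ := A.measurable_blockRun _ _ _ _
  output := A.output

theorem memory_congr (x : Fin t → X) {a b : ℕ} (hab : a = b) (ha : a ≤ ℓ * t) (hb : b ≤ ℓ * t) :
    A.memory x a ha = A.memory x b hb := by
  subst hab; rfl

theorem pass_time_le {r a : ℕ} (hr : r < ℓ) (ha : a ≤ t) : r * t + a ≤ ℓ * t := by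
  calc r * t + a ≤ r * t + t := by omega
    _ = (r + 1) * t := by ring
    _ ≤ ℓ * t := Nat.mul_le_mul_right t hr

theorem memory_succ_pass (x : Fin t → X) {r a : ℕ} (hr : r < ℓ) (ha : a < t) :
    A.memory x (r * t + a + 1) (pass_time_le hr ha)
      = A.stepNat (r * t + a) (x ⟨a, ha⟩) (A.memory x (r * t + a) (pass_time_le hr ha.le)) := by
  have hlt : r * t + a < ℓ * t := pass_time_le hr ha
  rw [memory, stepNat, dif_pos hlt]
  congr 2
  apply Fin.ext
  simp [Fin.modNat, Nat.mod_eq_of_lt ha]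

/-- The minimum with `t` freezes the clock at the end of a pass while padding points are skipped. -/
theorem blockRun_memory {m k : ℕ} (h : t ≤ k * m) (y : Fin k → Fin m → X) {r i : ℕ}
    (hr : r < ℓ) (hi : i < k) (b : ℕ) (hb : b ≤ m) :
    A.blockRun r i (y ⟨i, hi⟩) (A.memory (flattenBlocks h y) (r * t + min (i * m) t)
        (pass_time_le hr (min_le_right _ _))) b
      = A.memory (flattenBlocks h y) (r * t + min (i * m + b) t)
        (pass_time_le hr (min_le_right _ _)) := by
  induction b with
  | zero => rfl
  | succ b ih =>
    rw [blockRun, ih (Nat.le_of_succ_le hb)]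
    split_ifs with hc
    · rw [← flattenBlocks_eq h y hi hc.1 hc.2]
      have e1 : r * t + min (i * m + b) t = r * t + (i * m + b) := by rw [min_eq_left hc.2.le]
      have e2 : r * t + min (i * m + (b + 1)) t = r * t + (i * m + b) + 1 := by
        rw [min_eq_left (by omega)]; omega
      rw [A.memory_congr _ e1 _ (pass_time_le hr hc.2.le),
        A.memory_congr _ e2 _ (pass_time_le hr hc.2), A.memory_succ_pass _ hr hc.2]
    · have : t ≤ i * m + b := by
        by_contra hlt
        exact hc ⟨hb, not_le.1 hlt⟩
      apply memory_congr
      rw [min_eq_right this, min_eq_right (by omega)]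

theorem blocked_time_le {m k : ℕ} (n : ℕ) (hn : n ≤ ℓ * k) :
    n / k * t + min (n % k * m) t ≤ ℓ * t := by
  rcases Nat.eq_zero_or_pos k with rfl | hk
  · obtain rfl : n = 0 := by omega
    simp
  rcases hn.eq_or_lt with rfl | hlt
  · simp [Nat.mul_div_cancel _ hk]
  · exact pass_time_le ((Nat.div_lt_iff_lt_mul hk).2 hlt) (min_le_right _ _)

theorem blocked_memory {m k : ℕ} (h : t ≤ k * m) (y : Fin k → Fin m → X) (n : ℕ)
    (hn : n ≤ ℓ * k) :
    (A.blocked m k).memory y n hn = A.memory (flattenBlocks h y) (n / k * t + min (n % k * m) t)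
      (blocked_time_le n hn) := by
  induction n with
  | zero =>
    have e : 0 / k * t + min (0 % k * m) t = 0 := by simp
    rw [A.memory_congr _ e _ (Nat.zero_le _)]
    rfl
  | succ n ih =>
    have hk : 0 < k := Nat.pos_of_ne_zero fun h0 => by subst h0; simp at hn
    have hr : n / k < ℓ := (Nat.div_lt_iff_lt_mul hk).2 hn
    rw [memory, ih (Nat.le_of_succ_le hn)]
    refine (A.blockRun_memory h y hr (Nat.mod_lt n hk) m le_rfl).trans ?_
    apply memory_congr
    have hmod := Nat.mod_lt n hk
    have hdiv := Nat.div_add_mod n k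
    rcases Nat.lt_or_ge (n % k + 1) k with hlt | hge
    · obtain ⟨e1, e2⟩ := (Nat.div_mod_unique (a := n + 1) (c := n % k + 1) (d := n / k) hk).2
        ⟨by omega, hlt⟩
      rw [e1, e2, add_mul, one_mul]
    · obtain ⟨e1, e2⟩ := (Nat.div_mod_unique (a := n + 1) (c := 0) (d := n / k + 1) hk).2
        ⟨by rw [mul_add]; omega, hk⟩
      have e3 : n % k * m + m = k * m := by
        rw [← Nat.succ_mul]; congr 1; omega
      rw [e1, e2, e3, min_eq_right h]
      simp [add_mul]

theorem blocked_result {m k : ℕ} (hk : 0 < k) (h : t ≤ k * m) (y : Fin k → Fin m → X) :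
    (A.blocked m k).result y = A.result (flattenBlocks h y) := by
  rw [result, blocked_memory A h, result]
  refine congrArg A.output (A.memory_congr _ ?_ _ _)
  simp [Nat.mul_div_cancel _ hk]

theorem IdentifiesWithError.blocked {ι : Type*} {A : MemoryAlgorithm X ι t s ℓ}
    {μ : ι → Measure X} [∀ i, IsProbabilityMeasure (μ i)] {ε : ℝ} (hA : A.IdentifiesWithError μ ε)
    {m k : ℕ} (hk : 0 < k) (h : t ≤ k * m) :
    (A.blocked m k).IdentifiesWithError (fun i => Measure.pi fun _ => μ i) ε := by
  intro i
  refine (hA i).trans (le_of_eq ?_)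
  rw [← map_flattenBlocks_pi h, map_measureReal_apply (measurable_flattenBlocks h)
    (A.measurableSet_result_eq i)]
  congr 1
  ext y
  simp [A.blocked_result hk h]

end MemoryAlgorithm

/-! ### Numerical estimates and the lower bound. -/

theorem card_coordPair_mul_two (d : ℕ) : (Fintype.card (CoordPair d) : ℝ) * 2 = d * (d - 1) := by
  have h : Fintype.card (CoordPair d) = d.choose 2 := by
    rw [Fintype.card_finset_len, Fintype.card_fin]
  rw [h, Nat.cast_choose_two]
  ring

/-- The bound in the regime in which the algorithm may memorize the empirical covariances. -/
theorem sq_le_mul_of_sq_le_memory {N k m t b D w : ℝ} (hN : 0 < N) (hw : 0 ≤ w)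
    (ht : 0 ≤ t) (hkm : k * m ≤ t + m) (hm : m = 8 * D) (hDw : D * w ≤ 1 / 10 ^ 10)
    (hD : 0 ≤ D) (hb : D ≤ b) (h : N ≤ 20 * (k * (N * (2 * (m * w))))) :
    D ≤ 10 ^ 5 * w * (t * b) := by
  -- After division by `N`, the padding costs only `m w = 8 D w`, which is negligible. Hence `t w ≥
  -- 1/80`, and `b ≥ D` finishes.
  have h1 : 1 ≤ 40 * (k * m) * w := by
    by_contra hlt
    push Not at hlt
    nlinarith
  have h2 : 40 * (k * m) * w ≤ 40 * (t + m) * w := by gcongr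
  have e : 40 * (t + m) * w = 40 * (t * w) + 320 * (D * w) := by rw [hm]; ring
  have h3 : 1 ≤ 80 * (t * w) := by linarith
  have h4 : t * w * D ≤ t * w * b := by gcongr
  nlinarith

/-- If the bound failed, `t w ≤ D / 10⁵` would hold, so the remainder, of order `N (t w + D w) (D
w)`, would be negligible as `D² w` is tiny. The main term `800 w t b` would be below `D / 125`,
contradicting `D ≤ 4 N`. -/
theorem sq_le_mul_of_memory_lt_sq {N k m t b D w : ℝ} (hw : 0 ≤ w) (ht : 0 ≤ t)
    (hkm : k * m ≤ t + m) (hm : m = 8 * D) (hD2w : D ^ 2 * w ≤ 1 / 10 ^ 10) (hD : 20 ≤ D)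
    (hND : D ≤ 4 * N) (hb1 : 1 ≤ b) (hb : b ≤ D)
    (h : N ≤ 20 * (k * (40 * w * b * m + N * (8 * (m * w) ^ 2)))) :
    D ≤ 10 ^ 5 * w * (t * b) := by
  by_contra hlt
  push Not at hlt
  have hDw : D * w ≤ 1 / 10 ^ 10 := by nlinarith [mul_nonneg (by linarith : 0 ≤ D) hw]
  have hDw0 : 0 ≤ D * w := mul_nonneg (by linarith) hw
  have hN : 0 < N := by linarith
  have htw : t * w ≤ t * w * b := le_mul_of_one_le_right (by positivity) hb1
  have htwD : 10 ^ 5 * (t * w) ≤ D := by nlinarith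
  have hm0 : 0 ≤ m := by linarith
  have h1 : N ≤ (t + m) * (800 * w * b + 160 * N * (m * w ^ 2)) := by
    calc N ≤ (k * m) * (800 * w * b + 160 * N * (m * w ^ 2)) := by linarith
      _ ≤ _ := by gcongr
  have h2 : (t + m) * (800 * w * b + 160 * N * (m * w ^ 2)) = 800 * (w * (t * b))
      + 6400 * (D * w * b) + N * (1280 * ((t * w) * (D * w)) + 10240 * (D * w) ^ 2) := by
    rw [hm]; ring
  have h3 : D * w * b ≤ 1 / 10 ^ 10 := by
    calc D * w * b ≤ D * w * D := by gcongr
      _ = D ^ 2 * w := by ring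
      _ ≤ _ := hD2w
  have h4 : (t * w) * (D * w) ≤ 1 / 10 ^ 10 := by
    calc (t * w) * (D * w) ≤ D * (D * w) := by
          gcongr
          have : 0 ≤ t * w := by positivity
          linarith
      _ = D ^ 2 * w := by ring
      _ ≤ _ := hD2w
  have h5 : (D * w) ^ 2 ≤ 1 / 10 ^ 10 := by nlinarith
  have h6 : N * (1280 * ((t * w) * (D * w)) + 10240 * (D * w) ^ 2) ≤ N * (1 / 10) := by
    gcongr
    linarith
  linarith

/-- The memory lower bound for identifying a weakly correlated pair of coordinates. -/
theorem sq_le_mul_of_identifiesWithError {d : ℕ} (hd : 5 ≤ d) {σ : ℝ} (hσ0 : 0 < σ)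
    (hσ : 10 ^ 5 * (d : ℝ) ^ 3 * σ ≤ 1) {t s ℓ : ℕ} (hs : 1 ≤ s) (hℓ : 1 ≤ ℓ)
    (A : MemoryAlgorithm (EuclideanSpace ℝ (Fin d)) (CoordPair d) t s ℓ)
    (hA : A.IdentifiesWithError (pairGaussian d σ) (1 / 6)) :
    (d : ℝ) ^ 2 ≤ 10 ^ 5 * σ ^ 2 * (t * (s * ℓ)) := by
  have hdr : (5 : ℝ) ≤ d := by exact_mod_cast hd
  set D : ℝ := (d : ℝ) ^ 2 with hD
  have hD25 : 25 ≤ D := by nlinarith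
  have hcard := card_coordPair_mul_two d
  set N : ℝ := ((Fintype.card (CoordPair d) : ℕ) : ℝ) with hN
  have hND : D ≤ 4 * N := by nlinarith
  have hN10 : 10 ≤ N := by nlinarith
  have hdσ : (d : ℝ) ^ 3 * σ ≤ 1 / 10 ^ 5 := by linarith
  have hD3 : D ^ 3 * σ ^ 2 ≤ 1 / 10 ^ 10 := by
    calc D ^ 3 * σ ^ 2 = ((d : ℝ) ^ 3 * σ) ^ 2 := by rw [hD]; ring
      _ ≤ (1 / 10 ^ 5) ^ 2 := by gcongr
      _ = _ := by norm_num
  have hw : 0 < σ ^ 2 := by positivity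
  have hD2 : D ^ 2 * σ ^ 2 ≤ 1 / 10 ^ 10 := by
    refine le_trans ?_ hD3
    gcongr
    · linarith
    · norm_num
  have hD1 : D * σ ^ 2 ≤ 1 / 10 ^ 10 := by
    refine le_trans ?_ hD2
    gcongr
    nlinarith
  -- With this block size, `l² = s ℓ / m ≤ 1/8` holds whenever `s ℓ ≤ d²`, as the exponential moment
  -- bound requires.
  set m : ℕ := 8 * d ^ 2 with hm
  have hmr : (m : ℝ) = 8 * D := by rw [hm, hD]; push_cast; rfl
  have hm0 : 0 < m := by positivity
  set k : ℕ := t / m + 1 with hk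
  have htk : t ≤ k * m := (Nat.lt_mul_of_div_lt (Nat.lt_succ_self _) hm0).le.trans_eq rfl
  have hkm : (k : ℝ) * m ≤ t + m := by
    have : k * m ≤ t + m := by
      rw [hk, add_mul, one_mul]
      exact Nat.add_le_add_right (Nat.div_mul_le_self t m) m
    exact_mod_cast this
  have hσm : (m : ℝ) * σ ^ 2 ≤ 1 / 4 := by rw [hmr]; linarith
  have hσ' : 2 * σ ^ 2 < 1 := by nlinarith
  have hA' := hA.blocked (m := m) (Nat.succ_pos (t / m)) htk
  have hmain := (A.blocked m k).card_le_sum_relChange_sq (nullBlock d m)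
    (fun I => pairBlock d m σ I) (fun I => pairBlock_absolutelyContinuous hσ' I)
    (by rw [hN] at hN10; exact_mod_cast hN10) hA'
  have hmeas := (A.blocked m k).measurableSet_cell
  have hpart := (A.blocked m k).existsUnique_transcript
  rcases le_total D (s * ℓ : ℝ) with hb | hb
  · refine sq_le_mul_of_sq_le_memory (N := N) (k := k) (by linarith) hw.le (Nat.cast_nonneg t) hkm
      hmr hD1 (by linarith) hb (hmain.trans ?_)
    have h : ∀ j, ∑ I : CoordPair d, ∑ π, (∏ a, (nullBlock d m).real ((A.blocked m k).cell a π))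
        * relChange (nullBlock d m) (pairBlock d m σ I) ((A.blocked m k).cell j π) ^ 2
        ≤ N * (2 * (m * σ ^ 2)) := fun j => by
      refine (Finset.sum_le_sum fun I _ =>
        sum_prod_mul_relChange_block_sq_le hσm hσ' I hmeas hpart j).trans_eq ?_
      rw [Finset.sum_const, nsmul_eq_mul, Finset.card_univ]
    gcongr
    refine (Finset.sum_le_sum fun j _ => h j).trans_eq ?_
    rw [Finset.sum_const, nsmul_eq_mul, Finset.card_univ, Fintype.card_fin]
  · have hb1 : (1 : ℝ) ≤ s * ℓ := by
      have : 1 ≤ s * ℓ := Nat.mul_pos hs hℓ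
      exact_mod_cast this
    set b : ℝ := s * ℓ with hb_def
    refine sq_le_mul_of_memory_lt_sq (N := N) (k := k) hw.le (Nat.cast_nonneg t) hkm hmr hD2
      (by linarith) hND hb1 hb (hmain.trans ?_)
    have hmpos : (0 : ℝ) < m := by exact_mod_cast hm0
    -- The choice `l = √(b / m)` balances `l² m²` against `b² / l²`, making both equal to `b m`.
    have hl2 : √(b / m) ^ 2 = b / m := Real.sq_sqrt (by positivity)
    have hl8 : √(b / m) ^ 2 ≤ 1 / 8 := by
      rw [hl2, hmr, div_le_div_iff₀ (by linarith) (by norm_num)]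
      linarith
    have hlog : Real.log ((2 ^ (s * ℓ) : ℕ) : ℝ) ≤ b := by
      push_cast
      rw [Real.log_pow]
      push_cast
      rw [← hb_def]
      nlinarith [Real.log_two_lt_d9]
    have hlog0 : 0 ≤ Real.log ((2 ^ (s * ℓ) : ℕ) : ℝ) := Real.log_natCast_nonneg _
    have h : ∀ j, ∑ I : CoordPair d, ∑ π, (∏ a, (nullBlock d m).real ((A.blocked m k).cell a π))
        * relChange (nullBlock d m) (pairBlock d m σ I) ((A.blocked m k).cell j π) ^ 2
        ≤ 40 * σ ^ 2 * b * m + N * (8 * (m * σ ^ 2) ^ 2) := fun j => by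
      refine (sum_sum_prod_mul_relChange_block_sq_le hσm hσ' hmeas hpart j Nat.one_le_two_pow
        ((A.blocked m k).card_transcripts_le j) (Real.sqrt_pos.2 (by positivity)) hl8).trans ?_
      rw [hl2]
      refine add_le_add ?_ le_rfl
      calc _ ≤ 2 * σ ^ 2 * (8 * (b / m) * m ^ 2 + 2 / (b / m) * (6 * b ^ 2)) := by
            refine mul_le_mul_of_nonneg_left (add_le_add le_rfl ?_) (by positivity)
            refine mul_le_mul_of_nonneg_left ?_ (by positivity)
            have := pow_le_pow_left₀ hlog0 hlog 2
            nlinarith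
        _ = _ := by
            have : b ≠ 0 := by linarith
            field_simp
            ring
    gcongr
    refine (Finset.sum_le_sum fun j _ => h j).trans_eq ?_
    rw [Finset.sum_const, nsmul_eq_mul, Finset.card_univ, Fintype.card_fin]

theorem theorem6 :
    ∃ C C' : ℝ, 0 < C ∧ 0 < C' ∧
      ∀ d : ℕ, C' ≤ (d : ℝ) →
      ∀ σ : ℝ, 0 < σ → σ < 1 →
        σ ≤ (C * (d : ℝ) ^ 3 * Real.sqrt (Real.log d) * Real.log (d / σ))⁻¹ →
      ∀ t s ℓ : ℕ, 1 ≤ t → 1 ≤ s → 1 ≤ ℓ →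
      ∀ A : MemoryAlgorithm (EuclideanSpace ℝ (Fin d)) (CoordPair d) t s ℓ,
        A.IdentifiesWithError (pairGaussian d σ) (1 / 6) →
        (t : ℝ) * s * ℓ ≥
          (d : ℝ) ^ 2 / (C * σ ^ 2 * Real.log d ^ 3 * Real.log (1 / σ) ^ 2) := by
  -- From `d ≥ 5` there are at least `10` pairs and `log d ≥ 1`.
  refine ⟨10 ^ 5, 5, by norm_num, by norm_num, ?_⟩
  intro d hd σ hσ0 hσ1 hσ t s ℓ _ hs hℓ A hA
  have one_le_log : ∀ x : ℝ, 5 ≤ x → 1 ≤ Real.log x := fun x hx => by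
    rw [Real.le_log_iff_exp_le (by linarith)]
    linarith [Real.exp_one_lt_d9]
  have hlogd := one_le_log d hd
  have hlogdσ : 1 ≤ Real.log (d / σ) := one_le_log _ <| hd.trans <|
    (le_div_iff₀ hσ0).2 (mul_le_of_le_one_right (by linarith) hσ1.le)
  have hd3 : (1 : ℝ) ≤ (d : ℝ) ^ 3 := one_le_pow₀ (by linarith)
  have hσd : 10 ^ 5 * (d : ℝ) ^ 3 * σ ≤ 1 := by
    have h1 : σ ≤ (10 ^ 5 * (d : ℝ) ^ 3)⁻¹ := by
      refine hσ.trans (inv_anti₀ (by positivity) ?_)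
      rw [mul_assoc]
      refine le_mul_of_one_le_right (by positivity) ?_
      exact one_le_mul_of_one_le_of_one_le (Real.one_le_sqrt.2 hlogd) hlogdσ
    rw [← le_inv_mul_iff₀ (by positivity), mul_one]
    exact h1
  have hlogσ : 1 ≤ Real.log (1 / σ) := one_le_log _ <| by
    rw [le_div_iff₀ hσ0]
    nlinarith
  have hmain := sq_le_mul_of_identifiesWithError (by exact_mod_cast hd) hσ0 hσd hs hℓ A hA
  rw [ge_iff_le, div_le_iff₀ (by positivity)]
  have h3 : 1 ≤ Real.log d ^ 3 * Real.log (1 / σ) ^ 2 :=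
    one_le_mul_of_one_le_of_one_le (one_le_pow₀ hlogd) (one_le_pow₀ hlogσ)
  calc (d : ℝ) ^ 2 ≤ 10 ^ 5 * σ ^ 2 * (t * (s * ℓ)) := hmain
    _ ≤ 10 ^ 5 * σ ^ 2 * (t * (s * ℓ)) * (Real.log d ^ 3 * Real.log (1 / σ) ^ 2) :=
        le_mul_of_one_le_right (by positivity) h3
    _ = _ := by ring
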